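/- Let $m \ge 2$, put $n = 2^{m-2}$, and let $D_{2^m} = D_{4n}$ be the dihedral group of order $2^m$, with presentation $\langle a, b \mid a^{2n} = b^2 = e,\ aba = b\rangle$ (for $m = 2$ it is the Klein four-group). Modules over $R = \mathbb{Z}[D_{2^m}]$ are right modules. An *algebraic 2-complex* over $R$ is a sequence $F_2 \xrightarrow{d_2} F_1 \xrightarrow{d_1} F_0$ of finitely generated free $R$-modules which is exact at $F_1$ and for which $\operatorname{coker}(d_1)$ is isomorphic to $\mathbb{Z}$ with trivial action; its algebraic $\pi_2$ is $\ker(d_2)$. Let $J$ be the algebraic $\pi_2$ of the Cayley complex of the above presentation, that is, $J = \ker(\partial_2 : R^3 \to R^2)$, where $\partial_2$ acts on column vectors by left multiplication by $$\begin{pmatrix} \Sigma & 0 & 1 + ba \\ 0 & 1 + b & a - 1 \end{pmatrix}, \qquad \Sigma = \sum_{i=0}^{2n-1} a^i.$$ **Theorem.** For every integer $r \ge 0$ there is an algebraic 2-complex over $R$ whose algebraic $\pi_2$ is isomorphic to $J \oplus R^r$, and any two algebraic 2-complexes over $R$ whose algebraic $\pi_2$ is isomorphic to $J \oplus R^r$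 are chain homotopy equivalent. -/

import Mathlib

open CategoryTheory

universe u

noncomputable section

/-! Modules over a group ring are right modules, that is, modules over the opposite ring
`(MonoidAlgebra ℤ G)ᵐᵒᵖ`; the element `x · g` is `MulOpposite.op (MonoidAlgebra.of ℤ G g) • x`. -/

/-- The opposite of the integral group ring: left modules over it are right `ℤ[G]`-modules. -/
abbrev GroupRingOp (G : Type) [Group G] : Type := (MonoidAlgebra ℤ G)ᵐᵒᵖ

/-- An algebraic 2-complex `F₂ → F₁ → F₀` over `ℤ[G]`: finitely generated free modules, exact
at `F₁`, with cokernel of `d₁` isomorphic to `ℤ` with trivial action.  It is regarded as a chain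
complex which vanishes in degrees greater than 2. -/
structure IsAlgebraicTwoComplex {G : Type} [Group G]
    (F : ChainComplex (ModuleCat.{u} (GroupRingOp G)) ℕ) : Prop where
  free : ∀ i, Module.Free (GroupRingOp G) (F.X i)
  finite : ∀ i, Module.Finite (GroupRingOp G) (F.X i)
  isZero : ∀ i, 2 < i → Limits.IsZero (F.X i)
  exact : Function.Exact (F.d 2 1).hom (F.d 1 0).hom
  coker : ∃ e : (F.X 0 ⧸ LinearMap.range (F.d 1 0).hom) ≃+ ℤ,
    ∀ (g : G) (x : F.X 0 ⧸ LinearMap.range (F.d 1 0).hom),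
      e (MulOpposite.op (MonoidAlgebra.of ℤ G g) • x) = e x

/-- The algebraic `π₂` of a complex: the kernel of `d₂`. -/
abbrev algebraicPiTwo {G : Type} [Group G]
    (F : ChainComplex (ModuleCat.{u} (GroupRingOp G)) ℕ) :
    Submodule (GroupRingOp G) (F.X 2) :=
  LinearMap.ker (F.d 2 1).hom

section Cayley

variable {G : Type} [Group G] {k l : ℕ}

/-- The 1-chain of the path which the word `x₁ x₂ ⋯ xₛ` traces in the universal cover of the
presentation complex, starting at the base vertex `1`.  The basis edge `e_x` runs from `1` to
`gen x`, and its translate `e_x · g` runs from `g` to `gen x * g`, so that the path reads the word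
from right to left and ends at the value of the word. -/
def pathChain (gen : Fin k → G) : List (Fin k) → (Fin k → MonoidAlgebra ℤ G)
  | [] => 0
  | x :: w => pathChain gen w + Pi.single x (MonoidAlgebra.of ℤ G (w.map gen).prod)

/-- The matrix of the second boundary map of the (universal cover of the) Cayley complex of a
presentation whose generators have the values `gen` in `G` and whose `j`-th relation is the
equation `(rel j).1 = (rel j).2` between words: the `j`-th column is the boundary of the
`j`-th 2-cell. -/
def cayleyBoundaryTwo (gen : Fin k → G) (rel : Fin l → List (Fin k) × List (Fin k)) :
    Matrix (Fin k) (Fin l) (MonoidAlgebra ℤ G) :=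
  Matrix.of fun i j => pathChain gen (rel j).1 i - pathChain gen (rel j).2 i

/-- The algebraic `π₂` of the Cayley complex of a presentation: the kernel of the second boundary
map, which acts on column vectors by left multiplication and is linear for right modules. -/
def cayleyPiTwo (gen : Fin k → G) (rel : Fin l → List (Fin k) × List (Fin k)) :
    Submodule (GroupRingOp G) (Fin l → MonoidAlgebra ℤ G) :=
  LinearMap.ker
    (Matrix.mulVecBilin (MonoidAlgebra ℤ G) (GroupRingOp G) (cayleyBoundaryTwo gen rel))

end Cayley

/-- The generators `a` (a rotation) and `b` (a reflection) of the dihedral group of order `4n`. -/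
def dihedralGen (n : ℕ) : Fin 2 → DihedralGroup (2 * n) :=
  ![DihedralGroup.r 1, DihedralGroup.sr 0]

/-- The relations `a²ⁿ = e`, `b² = e`, `aba = b`. -/
def dihedralRel (n : ℕ) : Fin 3 → List (Fin 2) × List (Fin 2) :=
  ![(List.replicate (2 * n) 0, []), ([1, 1], []), ([0, 1, 0], [1])]

/-- The module `J` over `ℤ[D₄ₙ]`: the algebraic `π₂` of the Cayley complex of the presentation
`⟨a, b | a²ⁿ = b² = e, aba = b⟩`. -/
abbrev dihedralJ (n : ℕ) :
    Submodule (GroupRingOp (DihedralGroup (2 * n)))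
      (Fin 3 → MonoidAlgebra ℤ (DihedralGroup (2 * n))) :=
  cayleyPiTwo (dihedralGen n) (dihedralRel n)

/-- The module `J ⊕ ℤ[D₄ₙ]^r`. -/
abbrev dihedralJStab (n r : ℕ) : Type :=
  dihedralJ n × (Fin r → MonoidAlgebra ℤ (DihedralGroup (2 * n)))

/-- The generators do satisfy the relations. -/
theorem dihedralRel_holds (n : ℕ) (j : Fin 3) :
    ((dihedralRel n j).1.map (dihedralGen n)).prod =
      ((dihedralRel n j).2.map (dihedralGen n)).prod := by
  fin_cases j <;> simp [dihedralRel, dihedralGen]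

theorem pathChain_replicate {G : Type} [Group G] {k : ℕ} (gen : Fin k → G) (x : Fin k) (s : ℕ) :
    pathChain gen (List.replicate s x) =
      Pi.single x (∑ i ∈ Finset.range s, MonoidAlgebra.of ℤ G (gen x) ^ i) := by
  induction s with
  | zero => simp [pathChain]
  | succ s ih =>
    rw [List.replicate_succ, pathChain, ih, Finset.sum_range_succ, Pi.single_add]
    simp

/-- The second boundary map of the presentation of the dihedral group, written out. -/
theorem cayleyBoundaryTwo_dihedral (n : ℕ) (a b : MonoidAlgebra ℤ (DihedralGroup (2 * n)))
    (ha : a = MonoidAlgebra.of ℤ (DihedralGroup (2 * n)) (DihedralGroup.r 1))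
    (hb : b = MonoidAlgebra.of ℤ (DihedralGroup (2 * n)) (DihedralGroup.sr 0)) :
    cayleyBoundaryTwo (dihedralGen n) (dihedralRel n) =
      !![∑ i ∈ Finset.range (2 * n), a ^ i, 0, 1 + b * a;
         0, 1 + b, a - 1] := by
  ext i j : 2
  fin_cases j
  · fin_cases i <;>
      simp [cayleyBoundaryTwo, dihedralRel, pathChain_replicate, pathChain, dihedralGen, ha,
        - MonoidAlgebra.of_apply]
  · fin_cases i <;>
      simp [cayleyBoundaryTwo, dihedralRel, pathChain, dihedralGen, hb, map_one,
        - MonoidAlgebra.of_apply]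
  · fin_cases i <;>
      simp [cayleyBoundaryTwo, dihedralRel, pathChain, dihedralGen, ha, hb, ← map_mul, map_one,
        - MonoidAlgebra.of_apply]

end

/-! The proof classifies algebraic 2-complexes by their k-invariants. Over a finite group G, free
modules are injective relative to maps with torsion-free cokernel, so a homomorphism between second
homotopy modules extends to a chain map (`exists_hom`), which acts on ℤ by an integer, its degree. A
chain map that vanishes on π₂ is null homotopic up to a norm term (`Hom.exists_nullHomotopy`). Hence
the map on π₂ determines the degree modulo |G|, and every integer in that class occurs
(`Hom.exists_deg_add`). An isomorphism on π₂ therefore has degree prime to |G|, and in degree 1 it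
comes from a homotopy equivalence (`nonempty_homotopyEquiv`).

It remains to realise every unit modulo 4n by an automorphism of J ⊕ R^r. A unit is odd, say 2q + 1,
and `dihedralSelfMap` is an explicit self map of that degree. On the first coordinate of R³ it
multiplies by v = (1 + a + ⋯ + a^q) - (1 + a + ⋯ + a^(q-1)) b. This v divides 1 + a + ⋯ + a^(2q) on
both sides, and the latter is invertible modulo Σ when 2q + 1 is prime to 2n; the equations defining
J take care of the multiples of Σ (`dihedralSelfMap_bijective`). Two complexes are then compared
through the Cayley complex, with such a self map inserted to bring the degree to 1. -/

noncomputable section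

/-! ### Norms and weak injectivity -/

section RightTranslate

variable {G : Type} [Group G] {M N : Type*} [AddCommGroup M] [Module (GroupRingOp G) M]
  [AddCommGroup N] [Module (GroupRingOp G) N]

/-- Right translation `x ↦ x · g` on a right `ℤ[G]`-module. -/
def rightTranslate (g : G) : M →+ M :=
  DistribSMul.toAddMonoidHom M (MulOpposite.op (MonoidAlgebra.of ℤ G g) : GroupRingOp G)

theorem rightTranslate_apply (g : G) (x : M) :
    rightTranslate g x = (MulOpposite.op (MonoidAlgebra.of ℤ G g) : GroupRingOp G) • x := rfl

theorem rightTranslate_mul (g h : G) (x : M) :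
    rightTranslate (g * h) x = rightTranslate h (rightTranslate g x) := by
  simp only [rightTranslate_apply, smul_smul, map_mul, MulOpposite.op_mul]

theorem map_rightTranslate (f : M →ₗ[GroupRingOp G] N) (g : G) (x : M) :
    f (rightTranslate g x) = rightTranslate g (f x) := by
  simp only [rightTranslate_apply, map_smul]

/-- An additive map commuting with right translations is linear. -/
def linearOfEquivariant (f : M →+ N)
    (hf : ∀ (g : G) (x : M), f (rightTranslate g x) = rightTranslate g (f x)) :
    M →ₗ[GroupRingOp G] N where
  toFun := f
  map_add' := map_add f
  map_smul' c x := by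
    induction c using MulOpposite.rec' with
    | _ c =>
    induction c using MonoidAlgebra.induction_on with
    | of g => exact hf g x
    | add a b ha hb =>
      simp only [MulOpposite.op_add, add_smul, map_add, ha, hb]
    | smul r a ha =>
      simp only [MulOpposite.op_smul, smul_assoc, map_zsmul] at ha ⊢
      rw [ha]

@[simp] theorem linearOfEquivariant_apply (f : M →+ N)
    (hf : ∀ (g : G) (x : M), f (rightTranslate g x) = rightTranslate g (f x)) (x : M) :
    linearOfEquivariant f hf x = f x := rfl

variable [Fintype G]

/-- The norm `x ↦ ∑ g, x · g`. -/
def groupNorm (x : M) : M := ∑ g : G, rightTranslate g x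

theorem rightTranslate_groupNorm (g : G) (x : M) :
    rightTranslate g (groupNorm (G := G) x) = groupNorm (G := G) x := by
  simp only [groupNorm, map_sum, ← rightTranslate_mul]
  exact Fintype.sum_equiv (Equiv.mulRight g) _ _ fun _ => rfl

/-- A module is weakly injective if the identity is the trace of an additive endomorphism. -/
def IsWeaklyInjective (G : Type) [Group G] [Fintype G] (M : Type*) [AddCommGroup M]
    [Module (GroupRingOp G) M] : Prop :=
  ∃ e : M →+ M, ∀ x, ∑ g : G, rightTranslate g (e (rightTranslate g⁻¹ x)) = x

/-- The endomorphism keeps only the coefficient at the identity: the coefficient of x · g⁻¹ there is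
the coefficient of x at g, so the trace rebuilds x term by term. -/
theorem isWeaklyInjective_self : IsWeaklyInjective G (GroupRingOp G) := by
  let c : GroupRingOp G →+ ℤ :=
    { toFun := fun x => x.unop.coeff 1
      map_zero' := rfl
      map_add' := fun _ _ => rfl }
  have hc : ∀ x, c x = x.unop.coeff 1 := fun _ => rfl
  refine ⟨(zmultiplesHom (GroupRingOp G) 1).comp c, fun x => ?_⟩
  apply MulOpposite.unop_injective
  rw [Finset.unop_sum]
  ext h
  simp only [rightTranslate_apply, AddMonoidHom.comp_apply, zmultiplesHom_apply, smul_eq_mul,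
    MulOpposite.unop_mul, MulOpposite.unop_op, MulOpposite.unop_smul, MulOpposite.unop_one,
    MonoidAlgebra.coeff_sum, Finsupp.finsetSum_apply, hc, MonoidAlgebra.of_apply,
    MonoidAlgebra.coeff_mul_single_apply, smul_mul_assoc, one_mul, MonoidAlgebra.coeff_smul,
    MonoidAlgebra.one_def, MonoidAlgebra.coeff_single, Finsupp.smul_apply]
  classical
  rw [Finset.sum_eq_single h]
  · simp
  · intro b _ hb
    simp [mul_inv_eq_one, hb.symm]
  · simp

theorem IsWeaklyInjective.of_free [Module.Free (GroupRingOp G) M] : IsWeaklyInjective G M := by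
  obtain ⟨e, he⟩ := isWeaklyInjective_self (G := G)
  let b := (Module.Free.chooseBasis (GroupRingOp G) M).repr
  refine ⟨b.symm.toLinearMap.toAddMonoidHom.comp
    ((Finsupp.mapRange.addMonoidHom e).comp b.toLinearMap.toAddMonoidHom),
    fun x => b.injective ?_⟩
  rw [map_sum]
  ext i : 1
  simp only [AddMonoidHom.comp_apply, LinearMap.toAddMonoidHom_coe, LinearEquiv.coe_coe,
    Finsupp.finsetSum_apply]
  conv_rhs => rw [← he (b x i)]
  refine Finset.sum_congr rfl fun g _ => ?_
  simp only [rightTranslate_apply, map_smul, LinearEquiv.apply_symm_apply, Finsupp.smul_apply,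
    Finsupp.mapRange.addMonoidHom_apply, Finsupp.mapRange_apply]

/-- Invariant elements of a weakly injective module are norms. -/
theorem IsWeaklyInjective.exists_groupNorm (hM : IsWeaklyInjective G M) (x : M)
    (hx : ∀ g : G, rightTranslate g x = x) : ∃ y : M, groupNorm (G := G) y = x := by
  obtain ⟨e, he⟩ := hM
  refine ⟨e x, ?_⟩
  conv_rhs => rw [← he x]
  simp only [hx, groupNorm]

end RightTranslate

/-! ### Extension of equivariant maps into free modules -/

section Extension

variable {G : Type} [Group G] {L M F : Type*}
  [AddCommGroup L] [Module (GroupRingOp G) L] [AddCommGroup M] [Module (GroupRingOp G) M]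
  [AddCommGroup F] [Module (GroupRingOp G) F]

theorem isTorsionFree_int_of_free [Module.Free (GroupRingOp G) M] :
    Module.IsTorsionFree ℤ M := by
  have : Module.IsTorsionFree ℤ (GroupRingOp G) :=
    Function.Injective.moduleIsTorsionFree (fun x : GroupRingOp G => (x.unop.coeff : G → ℤ))
      (DFunLike.coe_injective.comp (MonoidAlgebra.coeff_injective.comp
        MulOpposite.unop_injective)) fun _ _ => rfl
  exact Function.Injective.moduleIsTorsionFree (Module.Free.chooseBasis (GroupRingOp G) M).repr
    (LinearEquiv.injective _) fun _ _ => map_zsmul _ _ _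

variable [Fintype G]

theorem module_finite_int_groupRingOp : Module.Finite ℤ (GroupRingOp G) :=
  Module.Finite.equiv ((MonoidAlgebra.coeffLinearEquiv ℤ).symm.trans
    (MulOpposite.opLinearEquiv ℤ (M := MonoidAlgebra ℤ G)) : (G →₀ ℤ) ≃ₗ[ℤ] GroupRingOp G)

theorem module_finite_int_of_groupRingOp [Module.Finite (GroupRingOp G) M] :
    Module.Finite ℤ M :=
  have := module_finite_int_groupRingOp (G := G)
  Module.Finite.trans (GroupRingOp G) M

/-- Maps into a weakly injective module extend along a map whose cokernel is torsion free. -/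
theorem IsWeaklyInjective.exists_extension {Q : Type*} [AddCommGroup Q] [Module.IsTorsionFree ℤ Q]
    [Module.Finite (GroupRingOp G) M] (hF : IsWeaklyInjective G F)
    (i : L →ₗ[GroupRingOp G] M) (q : M →+ Q) (hq : ∀ x, q x = 0 ↔ ∃ l, i l = x)
    (f : L →ₗ[GroupRingOp G] F) (hf : ∀ l, i l = 0 → f l = 0) :
    ∃ s : M →ₗ[GroupRingOp G] F, ∀ l, s (i l) = f l := by
  obtain ⟨e, he⟩ := hF
  have := module_finite_int_of_groupRingOp (G := G) (M := M)
  let q' : M →ₗ[ℤ] Q := q.toIntLinearMap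
  -- The image of `q` is finitely generated and torsion free, hence free over ℤ, so `q` splits
  -- additively over its image.
  have hfin : Module.Finite ℤ (LinearMap.range q') := inferInstance
  have hfree : Module.Free ℤ (LinearMap.range q') := inferInstance
  obtain ⟨σ, hσ⟩ := Module.projective_lifting_property q'.rangeRestrict LinearMap.id
    q'.surjective_rangeRestrict
  have hσ' : ∀ x, q (σ (q'.rangeRestrict x)) = q x := fun x =>
    congrArg Subtype.val (LinearMap.congr_fun hσ (q'.rangeRestrict x))
  have hr : ∀ x, ∃ l, i l = x - σ (q'.rangeRestrict x) := fun x =>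
    (hq _).1 (by rw [map_sub, hσ', sub_self])
  choose r hr using hr
  have hfr : ∀ l l', i l = i l' → f l = f l' := fun l l' h =>
    sub_eq_zero.1 (by rw [← map_sub]; exact hf _ (by rw [map_sub, h, sub_self]))
  -- An additive extension of `f`; the choice of `r x` does not matter because `f` kills the kernel
  -- of `i`.
  let ψ : M →+ F := AddMonoidHom.mk' (fun x => f (r x)) fun x y => by
    rw [← map_add]
    apply hfr
    simp only [map_add, hr]
    abel
  have hψ : ∀ l, ψ (i l) = f l := fun l => by
    apply hfr
    have : q'.rangeRestrict (i l) = 0 := Subtype.ext ((hq _).2 ⟨l, rfl⟩)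
    rw [hr, this, map_zero, sub_zero]
  -- The trace of `e ∘ ψ` is equivariant. On the image of `i`, where `ψ` is already equivariant, it
  -- reduces to the trace of `e`, which is the identity.
  let s : M →+ F := ∑ g : G, (rightTranslate g).comp (e.comp (ψ.comp (rightTranslate g⁻¹)))
  have hs : ∀ x, s x = ∑ g : G, rightTranslate g (e (ψ (rightTranslate g⁻¹ x))) := fun x => by
    simp only [s, AddMonoidHom.finsetSum_apply, AddMonoidHom.comp_apply]
  refine ⟨linearOfEquivariant s fun h x => ?_, fun l => ?_⟩
  · simp only [hs, map_sum, ← rightTranslate_mul]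
    refine Fintype.sum_equiv (Equiv.mulRight h⁻¹) _ _ fun g => ?_
    simp
  · rw [linearOfEquivariant_apply, hs, ← he (f l)]
    simp only [← map_rightTranslate, hψ]

end Extension

/-! ### Chain maps of augmented complexes, their degrees and homotopies -/

/-- An augmented complex `X₂ → X₁ → X₀ → ℤ` of right `ℤ[G]`-modules, exact at `X₁`, `X₀`
and `ℤ`. -/
structure AugmentedTwoComplex (G : Type) [Group G] (X₂ X₁ X₀ : Type*)
    [AddCommGroup X₂] [Module (GroupRingOp G) X₂] [AddCommGroup X₁] [Module (GroupRingOp G) X₁]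
    [AddCommGroup X₀] [Module (GroupRingOp G) X₀] where
  d₂ : X₂ →ₗ[GroupRingOp G] X₁
  d₁ : X₁ →ₗ[GroupRingOp G] X₀
  aug : X₀ →+ ℤ
  exact : ∀ x, d₁ x = 0 ↔ ∃ y, d₂ y = x
  exact_aug : ∀ x, aug x = 0 ↔ ∃ y, d₁ y = x
  surjective : Function.Surjective aug
  aug_rightTranslate : ∀ (g : G) x, aug (rightTranslate g x) = aug x

namespace AugmentedTwoComplex

variable {G : Type} [Group G] {X₂ X₁ X₀ Y₂ Y₁ Y₀ Z₂ Z₁ Z₀ : Type*}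
  [AddCommGroup X₂] [Module (GroupRingOp G) X₂] [AddCommGroup X₁] [Module (GroupRingOp G) X₁]
  [AddCommGroup X₀] [Module (GroupRingOp G) X₀]
  [AddCommGroup Y₂] [Module (GroupRingOp G) Y₂] [AddCommGroup Y₁] [Module (GroupRingOp G) Y₁]
  [AddCommGroup Y₀] [Module (GroupRingOp G) Y₀]
  [AddCommGroup Z₂] [Module (GroupRingOp G) Z₂] [AddCommGroup Z₁] [Module (GroupRingOp G) Z₁]
  [AddCommGroup Z₀] [Module (GroupRingOp G) Z₀]

theorem d₁_d₂ (X : AugmentedTwoComplex G X₂ X₁ X₀) (x : X₂) : X.d₁ (X.d₂ x) = 0 :=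
  (X.exact _).2 ⟨x, rfl⟩

theorem aug_d₁ (X : AugmentedTwoComplex G X₂ X₁ X₀) (x : X₁) : X.aug (X.d₁ x) = 0 :=
  (X.exact_aug _).2 ⟨x, rfl⟩

/-- A chain map of augmented complexes which induces multiplication by `deg` on `ℤ`. -/
structure Hom (X : AugmentedTwoComplex G X₂ X₁ X₀) (Y : AugmentedTwoComplex G Y₂ Y₁ Y₀) where
  f₂ : X₂ →ₗ[GroupRingOp G] Y₂
  f₁ : X₁ →ₗ[GroupRingOp G] Y₁
  f₀ : X₀ →ₗ[GroupRingOp G] Y₀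
  deg : ℤ
  comm₂ : ∀ x, Y.d₂ (f₂ x) = f₁ (X.d₂ x)
  comm₁ : ∀ x, Y.d₁ (f₁ x) = f₀ (X.d₁ x)
  aug_f₀ : ∀ x, Y.aug (f₀ x) = deg * X.aug x

variable {X : AugmentedTwoComplex G X₂ X₁ X₀} {Y : AugmentedTwoComplex G Y₂ Y₁ Y₀}
  {Z : AugmentedTwoComplex G Z₂ Z₁ Z₀}

/-- Composition of chain maps. -/
def Hom.comp (g : Hom Y Z) (f : Hom X Y) : Hom X Z where
  f₂ := g.f₂ ∘ₗ f.f₂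
  f₁ := g.f₁ ∘ₗ f.f₁
  f₀ := g.f₀ ∘ₗ f.f₀
  deg := g.deg * f.deg
  comm₂ x := by simp only [LinearMap.comp_apply, g.comm₂, f.comm₂]
  comm₁ x := by simp only [LinearMap.comp_apply, g.comm₁, f.comm₁]
  aug_f₀ x := by simp only [LinearMap.comp_apply, g.aug_f₀, f.aug_f₀, mul_assoc]

variable (X) in
/-- The identity chain map. -/
def Hom.id : Hom X X where
  f₂ := LinearMap.id
  f₁ := LinearMap.id
  f₀ := LinearMap.id
  deg := 1
  comm₂ _ := rfl
  comm₁ _ := rfl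
  aug_f₀ _ := (one_mul _).symm

/-- The difference of two chain maps. -/
def Hom.sub (f g : Hom X Y) : Hom X Y where
  f₂ := f.f₂ - g.f₂
  f₁ := f.f₁ - g.f₁
  f₀ := f.f₀ - g.f₀
  deg := f.deg - g.deg
  comm₂ x := by simp only [LinearMap.sub_apply, map_sub, f.comm₂, g.comm₂]
  comm₁ x := by simp only [LinearMap.sub_apply, map_sub, f.comm₁, g.comm₁]
  aug_f₀ x := by simp only [LinearMap.sub_apply, map_sub, f.aug_f₀, g.aug_f₀, sub_mul]

theorem Hom.f₂_mem (f : Hom X Y) {x : X₂} (hx : X.d₂ x = 0) : Y.d₂ (f.f₂ x) = 0 := by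
  rw [f.comm₂, hx, map_zero]

/-- `f₀` carries boundaries to boundaries, so it induces an additive endomorphism of ℤ, which is
multiplication by its value at 1. -/
theorem exists_deg (X : AugmentedTwoComplex G X₂ X₁ X₀) (Y : AugmentedTwoComplex G Y₂ Y₁ Y₀)
    (f₁ : X₁ →ₗ[GroupRingOp G] Y₁) (f₀ : X₀ →ₗ[GroupRingOp G] Y₀)
    (h : ∀ x, Y.d₁ (f₁ x) = f₀ (X.d₁ x)) :
    ∃ k : ℤ, ∀ x, Y.aug (f₀ x) = k * X.aug x := by
  obtain ⟨x₀, hx₀⟩ := X.surjective 1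
  refine ⟨Y.aug (f₀ x₀), fun x => ?_⟩
  obtain ⟨z, hz⟩ := (X.exact_aug (x - X.aug x • x₀)).1 (by simp [hx₀])
  have := congrArg (fun t => Y.aug (f₀ t)) hz
  simp only [← h, aug_d₁, map_sub, map_zsmul, smul_eq_mul] at this
  linarith [mul_comm (X.aug x) (Y.aug (f₀ x₀))]

variable [Fintype G]

/-- Every homomorphism between the second homotopy modules extends to a chain map. -/
theorem exists_hom [Module.Finite (GroupRingOp G) X₂] [Module.Finite (GroupRingOp G) X₁]
    [Module.Finite (GroupRingOp G) X₀] [Module.Free (GroupRingOp G) X₁]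
    [Module.Free (GroupRingOp G) X₀] [Module.Free (GroupRingOp G) Y₂]
    [Module.Free (GroupRingOp G) Y₁] [Module.Free (GroupRingOp G) Y₀]
    (θ : LinearMap.ker X.d₂ →ₗ[GroupRingOp G] LinearMap.ker Y.d₂) :
    ∃ f : Hom X Y, ∀ x : LinearMap.ker X.d₂, f.f₂ x = θ x := by
  have := isTorsionFree_int_of_free (G := G) (M := X₁)
  have := isTorsionFree_int_of_free (G := G) (M := X₀)
  obtain ⟨f₂, hf₂⟩ := (IsWeaklyInjective.of_free (G := G) (M := Y₂)).exists_extension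
    (LinearMap.ker X.d₂).subtype X.d₂.toAddMonoidHom (fun x => by simp)
    ((LinearMap.ker Y.d₂).subtype ∘ₗ θ) (fun l hl => by
      have : l = 0 := Subtype.ext hl
      simp [this])
  obtain ⟨f₁, hf₁⟩ := (IsWeaklyInjective.of_free (G := G) (M := Y₁)).exists_extension
    X.d₂ X.d₁.toAddMonoidHom X.exact (Y.d₂ ∘ₗ f₂) (fun l hl => by
      rw [LinearMap.comp_apply, show f₂ l = θ ⟨l, hl⟩ from hf₂ ⟨l, hl⟩]
      exact (θ ⟨l, hl⟩).2)
  obtain ⟨f₀, hf₀⟩ := (IsWeaklyInjective.of_free (G := G) (M := Y₀)).exists_extension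
    X.d₁ X.aug X.exact_aug (Y.d₁ ∘ₗ f₁) (fun l hl => by
      obtain ⟨y, rfl⟩ := (X.exact l).1 hl
      rw [LinearMap.comp_apply, hf₁, LinearMap.comp_apply, Y.d₁_d₂])
  obtain ⟨k, hk⟩ := exists_deg X Y f₁ f₀ fun x => (hf₀ x).symm
  exact ⟨⟨f₂, f₁, f₀, k, fun x => (hf₁ x).symm, fun x => (hf₀ x).symm, hk⟩, hf₂⟩

/-- The linear map which sends `x` to `aug x` times the norm of `y`. -/
def augSMul (X : AugmentedTwoComplex G X₂ X₁ X₀) {M : Type*} [AddCommGroup M]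
    [Module (GroupRingOp G) M] (y : M) : X₀ →ₗ[GroupRingOp G] M :=
  linearOfEquivariant (((zmultiplesHom M) (groupNorm (G := G) y)).comp X.aug) fun g x => by
    simp [X.aug_rightTranslate, rightTranslate_groupNorm]

theorem augSMul_apply (X : AugmentedTwoComplex G X₂ X₁ X₀) {M : Type*} [AddCommGroup M]
    [Module (GroupRingOp G) M] (y : M) (x : X₀) :
    X.augSMul y x = X.aug x • groupNorm (G := G) y := rfl

theorem aug_groupNorm (X : AugmentedTwoComplex G X₂ X₁ X₀) (x : X₀) :
    X.aug (groupNorm (G := G) x) = Fintype.card G * X.aug x := by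
  simp [groupNorm, X.aug_rightTranslate]

/-- A chain map which vanishes on the second homotopy module is null homotopic up to a multiple
of the norm. -/
theorem Hom.exists_nullHomotopy [Module.Finite (GroupRingOp G) X₁]
    [Module.Finite (GroupRingOp G) X₀] [Module.Free (GroupRingOp G) X₀]
    [Module.Free (GroupRingOp G) Y₂] [Module.Free (GroupRingOp G) Y₁]
    [Module.Free (GroupRingOp G) Y₀] (f : Hom X Y) (hf : ∀ x, X.d₂ x = 0 → f.f₂ x = 0) :
    ∃ (s₁ : X₁ →ₗ[GroupRingOp G] Y₂) (s₀ : X₀ →ₗ[GroupRingOp G] Y₁) (y : Y₀),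
      (∀ x, f.f₂ x = s₁ (X.d₂ x)) ∧ (∀ x, f.f₁ x = Y.d₂ (s₁ x) + s₀ (X.d₁ x)) ∧
      (∀ x, f.f₀ x = Y.d₁ (s₀ x) + X.augSMul y x) ∧ f.deg = Fintype.card G * Y.aug y := by
  have := isTorsionFree_int_of_free (G := G) (M := X₀)
  obtain ⟨s₁, hs₁⟩ := (IsWeaklyInjective.of_free (G := G) (M := Y₂)).exists_extension
    X.d₂ X.d₁.toAddMonoidHom X.exact f.f₂ hf
  obtain ⟨s₀, hs₀⟩ := (IsWeaklyInjective.of_free (G := G) (M := Y₁)).exists_extension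
    X.d₁ X.aug X.exact_aug (f.f₁ - Y.d₂ ∘ₗ s₁) (fun l hl => by
      obtain ⟨y, rfl⟩ := (X.exact l).1 hl
      simp [hs₁, f.comm₂])
  obtain ⟨x₀, hx₀⟩ := X.surjective 1
  -- What is left of `f₀` kills boundaries and so factors through the augmentation. Its value at
  -- `x₀` is then invariant, hence a norm in the free module `Y₀`.
  let ρ : X₀ →ₗ[GroupRingOp G] Y₀ := f.f₀ - Y.d₁ ∘ₗ s₀
  have hρ₁ : ∀ x, ρ (X.d₁ x) = 0 := fun x => by simp [ρ, hs₀, ← f.comm₁, Y.d₁_d₂]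
  have hρ : ∀ x, ρ x = X.aug x • ρ x₀ := fun x => by
    obtain ⟨z, hz⟩ := (X.exact_aug (x - X.aug x • x₀)).1 (by simp [hx₀])
    rw [← sub_eq_zero, ← map_zsmul, ← map_sub, ← hz, hρ₁]
  obtain ⟨y, hy⟩ := (IsWeaklyInjective.of_free (G := G) (M := Y₀)).exists_groupNorm (ρ x₀)
    fun g => by rw [← map_rightTranslate, hρ, X.aug_rightTranslate, hx₀, one_smul]
  have h₀ : ∀ x, f.f₀ x = Y.d₁ (s₀ x) + X.augSMul y x := fun x => by
    rw [augSMul_apply, hy, ← hρ]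
    simp [ρ]
  refine ⟨s₁, s₀, y, fun x => (hs₁ x).symm, fun x => by simp [hs₀], h₀, ?_⟩
  have := f.aug_f₀ x₀
  rw [h₀, map_add, Y.aug_d₁, augSMul_apply, hx₀, one_smul, aug_groupNorm] at this
  linarith

/-- The degree of a chain map can be changed by multiples of the order of the group, without
changing the map in degree two. -/
theorem Hom.exists_deg_add (f : Hom X Y) (t : ℤ) :
    ∃ f' : Hom X Y, f'.f₂ = f.f₂ ∧ f'.deg = f.deg + Fintype.card G * t := by
  -- Adding the augmentation times the norm of `y` to `f₀` does not disturb the square with `d₁`,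
  -- since the augmentation kills boundaries.
  obtain ⟨y, hy⟩ := Y.surjective t
  exact ⟨{ f with
    f₀ := f.f₀ + X.augSMul y
    deg := f.deg + Fintype.card G * t
    comm₁ := fun x => by simp [f.comm₁, augSMul_apply, X.aug_d₁]
    aug_f₀ := fun x => by
      simp [augSMul_apply, f.aug_f₀, aug_groupNorm, hy]
      ring }, rfl, rfl⟩

/-- The degree of a chain map which is the identity on the second homotopy module is `1` modulo
the order of the group. -/
theorem Hom.deg_modEq_one [Module.Finite (GroupRingOp G) X₁]
    [Module.Finite (GroupRingOp G) X₀] [Module.Free (GroupRingOp G) X₂]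
    [Module.Free (GroupRingOp G) X₁] [Module.Free (GroupRingOp G) X₀] (f : Hom X X)
    (hf : ∀ x, X.d₂ x = 0 → f.f₂ x = x) : ∃ t : ℤ, f.deg = 1 + Fintype.card G * t := by
  obtain ⟨_, _, y, _, _, _, h⟩ := (f.sub (Hom.id X)).exists_nullHomotopy fun x hx => by
    change f.f₂ x - x = 0
    rw [hf x hx, sub_self]
  refine ⟨X.aug y, ?_⟩
  have : (f.sub (Hom.id X)).deg = f.deg - 1 := rfl
  linarith

/-- The degree of a chain map which is bijective on the second homotopy module is a unit modulo
the order of the group. -/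
theorem Hom.exists_deg_inverse [Module.Finite (GroupRingOp G) X₁]
    [Module.Finite (GroupRingOp G) X₀] [Module.Free (GroupRingOp G) X₂]
    [Module.Free (GroupRingOp G) X₁] [Module.Free (GroupRingOp G) X₀]
    [Module.Finite (GroupRingOp G) Y₂] [Module.Finite (GroupRingOp G) Y₁]
    [Module.Finite (GroupRingOp G) Y₀] [Module.Free (GroupRingOp G) Y₁]
    [Module.Free (GroupRingOp G) Y₀] (f : Hom X Y)
    (θ : LinearMap.ker X.d₂ ≃ₗ[GroupRingOp G] LinearMap.ker Y.d₂)
    (hθ : ∀ x : LinearMap.ker X.d₂, f.f₂ x = θ x) :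
    ∃ l t : ℤ, l * f.deg = 1 + Fintype.card G * t := by
  obtain ⟨g, hg⟩ := exists_hom (X := Y) (Y := X) (θ.symm : _ →ₗ[GroupRingOp G] _)
  obtain ⟨t, ht⟩ := (g.comp f).deg_modEq_one fun x hx => by
    change g.f₂ (f.f₂ x) = x
    rw [hθ ⟨x, hx⟩, hg]
    simp
  exact ⟨g.deg, t, ht⟩

/-- A chain map of degree `1` which is the identity on the second homotopy module is homotopic to
the identity. -/
theorem Hom.exists_homotopy_id [Module.Finite (GroupRingOp G) X₁]
    [Module.Finite (GroupRingOp G) X₀] [Module.Free (GroupRingOp G) X₂]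
    [Module.Free (GroupRingOp G) X₁] [Module.Free (GroupRingOp G) X₀] (f : Hom X X)
    (hf : ∀ x, X.d₂ x = 0 → f.f₂ x = x) (hdeg : f.deg = 1) :
    ∃ (s₁ : X₁ →ₗ[GroupRingOp G] X₂) (s₀ : X₀ →ₗ[GroupRingOp G] X₁),
      (∀ x, f.f₂ x = s₁ (X.d₂ x) + x) ∧ (∀ x, f.f₁ x = s₀ (X.d₁ x) + X.d₂ (s₁ x) + x) ∧
      (∀ x, f.f₀ x = X.d₁ (s₀ x) + x) := by
  obtain ⟨s₁, s₀, y, h₂, h₁, h₀, h⟩ := (f.sub (Hom.id X)).exists_nullHomotopy fun x hx => by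
    change f.f₂ x - x = 0
    rw [hf x hx, sub_self]
  have hy : X.aug y = 0 := by
    have h' : (f.sub (Hom.id X)).deg = f.deg - 1 := rfl
    rw [h', hdeg, sub_self, zero_eq_mul] at h
    exact h.resolve_left (by simp)
  -- As `y` is now a boundary, the norm term can be absorbed into `s₀`. The correction vanishes on
  -- boundaries, so the equation in degree one is unchanged.
  obtain ⟨z, rfl⟩ := (X.exact_aug y).1 hy
  have hz : ∀ x, X.augSMul (X.d₁ z) x = X.d₁ (X.augSMul z x) := fun x => by
    simp only [augSMul_apply, map_zsmul, groupNorm, map_sum, map_rightTranslate]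
  refine ⟨s₁, s₀ + X.augSMul z, fun x => ?_, fun x => ?_, fun x => ?_⟩
  · exact eq_add_of_sub_eq (h₂ x)
  · have : X.augSMul z (X.d₁ x) = 0 := by simp [augSMul_apply, X.aug_d₁]
    rw [LinearMap.add_apply, this, add_zero, add_comm (s₀ _)]
    exact eq_add_of_sub_eq (h₁ x)
  · rw [LinearMap.add_apply, map_add, ← hz]
    exact eq_add_of_sub_eq (h₀ x)

end AugmentedTwoComplex

instance MonoidAlgebra.isAddTorsionFree_int (G : Type*) :
    IsAddTorsionFree (MonoidAlgebra ℤ G) :=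
  Function.Injective.isAddTorsionFree (MonoidAlgebra.coeffAddEquiv (R := ℤ) (M := G)).toAddMonoidHom
    (AddEquiv.injective _)

/-! ### Geometric sums in a ring -/

section GeomSum

variable {A : Type*} [Ring A]

theorem geom_sum_mul_geom_sum_pow (a : A) (k j : ℕ) :
    (∑ i ∈ Finset.range k, a ^ i) * ∑ i ∈ Finset.range j, (a ^ k) ^ i =
      ∑ i ∈ Finset.range (k * j), a ^ i := by
  induction j with
  | zero => simp
  | succ j ih =>
    rw [Finset.sum_range_succ, mul_add, ih, Nat.mul_succ, Finset.sum_range_add, ← pow_mul,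
      Finset.sum_mul]
    congr 1
    exact Finset.sum_congr rfl fun i _ => by rw [← pow_add, add_comm]

/-- Together with `geom_sum_mul_geom_sum_pow` this inverts a sum of k powers modulo the sum of all N
powers, when k is prime to N. -/
theorem geom_sum_of_pow_eq_one (a : A) {N : ℕ} (ha : a ^ N = 1) (t : ℕ) :
    ∑ i ∈ Finset.range (N * t + 1), a ^ i = 1 + t * ∑ i ∈ Finset.range N, a ^ i := by
  have h : ∑ i ∈ Finset.range (N * t), a ^ i = t * ∑ i ∈ Finset.range N, a ^ i := by
    induction t with
    | zero => simp
    | succ t ih =>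
      rw [Nat.mul_succ, Finset.sum_range_add, ih]
      simp [pow_add, pow_mul, ha, add_mul]
  rw [Finset.sum_range_succ, h, pow_mul, ha, one_pow, add_comm]

theorem mul_geom_sum_of_pow_eq_one (a : A) {N : ℕ} (ha : a ^ N = 1) :
    a * ∑ i ∈ Finset.range N, a ^ i = ∑ i ∈ Finset.range N, a ^ i := by
  have := mul_geom_sum a N
  rwa [ha, sub_self, sub_mul, one_mul, sub_eq_zero] at this

theorem geom_sum_mul_of_mul_eq (a s : A) (h : a * s = s) (k : ℕ) :
    (∑ i ∈ Finset.range k, a ^ i) * s = k * s := by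
  have : ∀ i, a ^ i * s = s := fun i => by
    induction i with
    | zero => simp
    | succ i ih => rw [pow_succ, mul_assoc, h, ih]
  simp [Finset.sum_mul, this]

/-- If x and y are the sums of q + 1 and q powers, then a y = x - 1 and a^q = x - y, and both sides
become x² - y x + y. -/
theorem geom_sum_mul_self_sub (a : A) (q : ℕ) :
    (∑ i ∈ Finset.range (q + 1), a ^ i) * (∑ i ∈ Finset.range (q + 1), a ^ i) -
      (∑ i ∈ Finset.range q, a ^ i) * (a * ∑ i ∈ Finset.range q, a ^ i) =
      ∑ i ∈ Finset.range (2 * q + 1), a ^ i := by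
  have h₁ : a * ∑ i ∈ Finset.range q, a ^ i = (∑ i ∈ Finset.range (q + 1), a ^ i) - 1 := by
    rw [geom_sum_succ]; abel
  have h₂ : (∑ i ∈ Finset.range (q + 1), a ^ i) = (∑ i ∈ Finset.range q, a ^ i) + a ^ q :=
    Finset.sum_range_succ _ _
  have h₃ : ∑ i ∈ Finset.range (2 * q + 1), a ^ i =
      (∑ i ∈ Finset.range q, a ^ i) + a ^ q * (∑ i ∈ Finset.range (q + 1), a ^ i) := by
    rw [show 2 * q + 1 = q + (q + 1) by ring, Finset.sum_range_add, Finset.mul_sum]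
    simp only [pow_add]
  rw [h₁, h₃]
  generalize (∑ i ∈ Finset.range (q + 1), a ^ i) = x at *
  generalize (∑ i ∈ Finset.range q, a ^ i) = y at *
  have h₄ : a ^ q = x - y := by rw [h₂]; abel
  rw [h₄]
  noncomm_ring

end GeomSum

/-! ### The divisor v of 1 + a + ⋯ + a^(2q) in a ring with dihedral relations -/

section DihedralRelations

/-- Elements `a`, `c = a⁻¹` and `b` of a ring which satisfy the relations of a dihedral group. -/
structure IsDihedralTriple {A : Type*} [Ring A] (N : ℕ) (a c b : A) : Prop where
  mul_inv : a * c = 1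
  inv_mul : c * a = 1
  sq : b * b = 1
  conj : b * a = c * b
  pow_eq_one : a ^ N = 1

namespace IsDihedralTriple

variable {A : Type*} [Ring A] {N : ℕ} {a c b : A}

theorem mul_reflection_mul (h : IsDihedralTriple N a c b) : a * (b * a) = b := by
  rw [h.conj, ← mul_assoc, h.mul_inv, one_mul]

theorem reflection_mul_sq (h : IsDihedralTriple N a c b) : (b * a) * (b * a) = 1 := by
  rw [mul_assoc, h.mul_reflection_mul, h.sq]

theorem conj_pow (h : IsDihedralTriple N a c b) (i : ℕ) : b * a ^ i = c ^ i * b := by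
  induction i with
  | zero => simp
  | succ i ih => rw [pow_succ, ← mul_assoc, ih, mul_assoc, h.conj, ← mul_assoc, pow_succ]

theorem conj_geom_sum (h : IsDihedralTriple N a c b) (q : ℕ) :
    b * ∑ i ∈ Finset.range q, a ^ i = (∑ i ∈ Finset.range q, c ^ i) * b := by
  simp only [Finset.mul_sum, Finset.sum_mul, h.conj_pow]

theorem pow_mul_inv_pow (h : IsDihedralTriple N a c b) (q : ℕ) : a ^ q * c ^ q = 1 := by
  have hc : Commute a c := h.mul_inv.trans h.inv_mul.symm
  rw [← hc.mul_pow, h.mul_inv, one_pow]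

theorem inv_geom_sum_mul_pow (h : IsDihedralTriple N a c b) (q : ℕ) :
    (∑ i ∈ Finset.range (q + 1), c ^ i) * a ^ q = ∑ i ∈ Finset.range (q + 1), a ^ i := by
  have hc : Commute c a := h.inv_mul.trans h.mul_inv.symm
  induction q with
  | zero => simp
  | succ q ih =>
    rw [Finset.sum_range_succ, add_mul, ← hc.mul_pow, h.inv_mul, one_pow, pow_succ, ← mul_assoc,
      ih, Finset.sum_range_succ' _ (q + 1), Finset.sum_mul]
    simp only [pow_succ, pow_zero]

theorem inv_geom_sum_mul_pow_same (h : IsDihedralTriple N a c b) (q : ℕ) :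
    (∑ i ∈ Finset.range q, c ^ i) * a ^ q = a * ∑ i ∈ Finset.range q, a ^ i := by
  have h₁ := h.inv_geom_sum_mul_pow q
  rw [geom_sum_succ, Finset.sum_range_succ, add_mul, one_mul, add_left_inj] at h₁
  rw [← h₁, mul_assoc, ← mul_assoc, h.mul_inv, one_mul]

theorem geom_sum_mul_inv_pow (h : IsDihedralTriple N a c b) (q : ℕ) :
    (∑ i ∈ Finset.range (q + 1), a ^ i) * c ^ q = ∑ i ∈ Finset.range (q + 1), c ^ i := by
  rw [← h.inv_geom_sum_mul_pow, mul_assoc, h.pow_mul_inv_pow, mul_one]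

/-- The element `(1 + a + ⋯ + a^q) - (1 + a + ⋯ + a^(q-1)) b` divides `1 + a + ⋯ + a^(2q)`. -/
theorem swan_mul_right (h : IsDihedralTriple N a c b) (q : ℕ) :
    ((∑ i ∈ Finset.range (q + 1), a ^ i) - (∑ i ∈ Finset.range q, a ^ i) * b) *
      ((∑ i ∈ Finset.range (q + 1), a ^ i) + (∑ i ∈ Finset.range q, a ^ i) * b * a ^ q) =
      ∑ i ∈ Finset.range (2 * q + 1), a ^ i := by
  have h₁ := h.conj_geom_sum (q + 1)
  have h₂ := h.conj_geom_sum q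
  have h₃ := h.geom_sum_mul_inv_pow q
  have h₄ := h.inv_geom_sum_mul_pow_same q
  have h₅ := h.conj_pow q
  have h₆ : Commute (∑ i ∈ Finset.range (q + 1), a ^ i) (∑ i ∈ Finset.range q, a ^ i) :=
    Commute.sum_left _ _ _ fun i _ => Commute.sum_right _ _ _ fun j _ => Commute.pow_pow_self a i j
  rw [← geom_sum_mul_self_sub, ← h₄]
  have e₁ : (∑ i ∈ Finset.range (q + 1), a ^ i) * ((∑ i ∈ Finset.range q, a ^ i) * b * a ^ q) =
      (∑ i ∈ Finset.range q, a ^ i) * b * (∑ i ∈ Finset.range (q + 1), a ^ i) := by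
    rw [mul_assoc _ b, h₅, mul_assoc _ b, h₁, ← h₃, ← mul_assoc, h₆.eq]
    simp only [mul_assoc]
  have e₂ : (∑ i ∈ Finset.range q, a ^ i) * b * ((∑ i ∈ Finset.range q, a ^ i) * b * a ^ q) =
      (∑ i ∈ Finset.range q, a ^ i) * ((∑ i ∈ Finset.range q, c ^ i) * a ^ q) := by
    rw [mul_assoc _ b, ← mul_assoc b, ← mul_assoc b, h₂, mul_assoc _ b b, h.sq, mul_one]
  rw [sub_mul, mul_add, mul_add, e₁, e₂]
  abel

/-- The cofactor is not the one of `swan_mul_right`: here `a ^ q` stands in front. This side yields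
injectivity of left multiplication by v, the other surjectivity. -/
theorem swan_mul_left (h : IsDihedralTriple N a c b) (q : ℕ) :
    ((∑ i ∈ Finset.range (q + 1), a ^ i) + a ^ q * (∑ i ∈ Finset.range q, a ^ i) * b) *
      ((∑ i ∈ Finset.range (q + 1), a ^ i) - (∑ i ∈ Finset.range q, a ^ i) * b) =
      ∑ i ∈ Finset.range (2 * q + 1), a ^ i := by
  have h₁ := h.conj_geom_sum (q + 1)
  have h₂ := h.conj_geom_sum q
  have h₃ := h.inv_geom_sum_mul_pow q
  have h₄ := h.inv_geom_sum_mul_pow_same q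
  have hac : Commute a c := h.mul_inv.trans h.inv_mul.symm
  have h₆ : Commute (∑ i ∈ Finset.range (q + 1), a ^ i) (∑ i ∈ Finset.range q, a ^ i) :=
    Commute.sum_left _ _ _ fun i _ => Commute.sum_right _ _ _ fun j _ => Commute.pow_pow_self a i j
  have h₇ : Commute (a ^ q) (∑ i ∈ Finset.range q, a ^ i) :=
    Commute.sum_right _ _ _ fun j _ => Commute.pow_pow_self a q j
  have h₈ : ∀ k, Commute (a ^ q) (∑ i ∈ Finset.range k, c ^ i) := fun k =>
    Commute.sum_right _ _ _ fun j _ => hac.pow_pow q j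
  rw [← geom_sum_mul_self_sub, ← h₄]
  have e₁ : a ^ q * (∑ i ∈ Finset.range q, a ^ i) * b * (∑ i ∈ Finset.range (q + 1), a ^ i) =
      (∑ i ∈ Finset.range (q + 1), a ^ i) * ((∑ i ∈ Finset.range q, a ^ i) * b) := by
    rw [mul_assoc _ b, h₁, h₇.eq, mul_assoc, ← mul_assoc (a ^ q), (h₈ _).eq, h₃, ← mul_assoc,
      ← mul_assoc, h₆.eq]
  have e₂ : a ^ q * (∑ i ∈ Finset.range q, a ^ i) * b * ((∑ i ∈ Finset.range q, a ^ i) * b) =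
      (∑ i ∈ Finset.range q, a ^ i) * ((∑ i ∈ Finset.range q, c ^ i) * a ^ q) := by
    rw [mul_assoc _ b, ← mul_assoc b, h₂, mul_assoc _ b b, h.sq, mul_one, h₇.eq, mul_assoc,
      (h₈ _).eq]
  rw [add_mul, mul_sub, mul_sub, e₁, e₂]
  abel

theorem inv_mul_geom_sum (h : IsDihedralTriple N a c b) :
    c * ∑ i ∈ Finset.range N, a ^ i = ∑ i ∈ Finset.range N, a ^ i := by
  conv_lhs => rw [← mul_geom_sum_of_pow_eq_one a h.pow_eq_one]
  rw [← mul_assoc, h.inv_mul, one_mul]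

theorem reflection_mul_geom_sum (h : IsDihedralTriple N a c b) :
    b * ∑ i ∈ Finset.range N, a ^ i = (∑ i ∈ Finset.range N, a ^ i) * b := by
  rw [h.conj_geom_sum]
  obtain _ | q := N
  · simp
  · have hc : Commute (∑ i ∈ Finset.range (q + 1), a ^ i) c :=
      Commute.sum_left _ _ _ fun i _ => Commute.pow_left (h.mul_inv.trans h.inv_mul.symm) i
    have hs : ∀ i, (∑ i ∈ Finset.range (q + 1), a ^ i) * c ^ i =
        ∑ i ∈ Finset.range (q + 1), a ^ i := fun i => by
      induction i with
      | zero => simp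
      | succ i ih => rw [pow_succ, ← mul_assoc, ih, hc.eq, h.inv_mul_geom_sum]
    rw [← h.geom_sum_mul_inv_pow, hs]

theorem one_sub_mul_one_add (h : IsDihedralTriple N a c b) : (1 - b * a) * (1 + b * a) = 0 := by
  have := h.reflection_mul_sq
  rw [sub_mul, mul_add, mul_add, this]
  noncomm_ring

theorem one_add_mul_one_sub (h : IsDihedralTriple N a c b) : (1 + b * a) * (1 - b * a) = 0 := by
  have := h.reflection_mul_sq
  rw [add_mul, mul_sub, mul_sub, this]
  noncomm_ring

theorem one_add_mul_sub_one (h : IsDihedralTriple N a c b) :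
    (1 + b) * (a - 1) = (a - 1) * (1 - b * a) := by
  have := h.mul_reflection_mul
  rw [sub_mul, mul_sub a, this]
  noncomm_ring

theorem sub_one_mul_one_add (h : IsDihedralTriple N a c b) :
    (a - 1) * (1 + b * a) + (b - 1) * (a - 1) = 0 := by
  have := h.mul_reflection_mul
  rw [sub_mul, mul_add, this]
  noncomm_ring

theorem one_add_mul_sub_one_self (h : IsDihedralTriple N a c b) : (1 + b) * (b - 1) = 0 := by
  rw [add_mul, mul_sub b, h.sq]; noncomm_ring

theorem sub_one_mul_one_add_self (h : IsDihedralTriple N a c b) : (b - 1) * (1 + b) = 0 := by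
  rw [sub_mul, mul_add b, h.sq]; noncomm_ring

/-- Σ absorbs powers of a, and Σ b = b Σ = b a Σ. This relation dictates the degree-one component of
`dihedralSelfMap`. -/
theorem geom_sum_mul_swan (h : IsDihedralTriple N a c b) (q : ℕ) :
    (∑ i ∈ Finset.range N, a ^ i) *
      ((∑ i ∈ Finset.range (q + 1), a ^ i) - (∑ i ∈ Finset.range q, a ^ i) * b) =
      (1 + q * (1 - b * a)) * ∑ i ∈ Finset.range N, a ^ i := by
  have hc : ∀ k, (∑ i ∈ Finset.range N, a ^ i) * (∑ i ∈ Finset.range k, a ^ i) =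
      k * ∑ i ∈ Finset.range N, a ^ i := fun k => by
    rw [← geom_sum_mul_of_mul_eq a _ (mul_geom_sum_of_pow_eq_one a h.pow_eq_one)]
    exact (Commute.sum_left _ _ _ fun i _ => Commute.sum_right _ _ _ fun j _ =>
      Commute.pow_pow_self a i j).eq
  rw [mul_sub, ← mul_assoc, hc, hc, add_mul, mul_assoc (q : A) (1 - b * a),
    sub_mul 1 (b * a), mul_assoc b a,
    mul_geom_sum_of_pow_eq_one a h.pow_eq_one, h.reflection_mul_geom_sum]
  push_cast
  noncomm_ring

/-- Left multiplication by `(1 + a + ⋯ + a^q) - (1 + a + ⋯ + a^(q-1)) b` is injective on the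
elements which are killed by `1 + a + ⋯ + a^(N-1)`. -/
theorem eq_zero_of_swan_mul_eq_zero (h : IsDihedralTriple N a c b) {q j t : ℕ}
    (hj : (2 * q + 1) * j = N * t + 1) {z : A}
    (hz : (∑ i ∈ Finset.range N, a ^ i) * z = 0)
    (hv : ((∑ i ∈ Finset.range (q + 1), a ^ i) - (∑ i ∈ Finset.range q, a ^ i) * b) * z = 0) :
    z = 0 := by
  have h₁ := congrArg (fun y => (∑ i ∈ Finset.range j, (a ^ (2 * q + 1)) ^ i) *
    (((∑ i ∈ Finset.range (q + 1), a ^ i) + a ^ q * (∑ i ∈ Finset.range q, a ^ i) * b) * y)) hv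
  simp only [mul_zero] at h₁
  have hc : Commute (∑ i ∈ Finset.range j, (a ^ (2 * q + 1)) ^ i)
      (∑ i ∈ Finset.range (2 * q + 1), a ^ i) :=
    Commute.sum_left _ _ _ fun i _ => Commute.sum_right _ _ _ fun j _ => by
      rw [← pow_mul]; exact Commute.pow_pow_self a _ j
  rwa [← mul_assoc (_ + _), h.swan_mul_left, ← mul_assoc, hc.eq, geom_sum_mul_geom_sum_pow, hj,
    geom_sum_of_pow_eq_one a h.pow_eq_one, add_mul, one_mul, mul_assoc, hz, mul_zero,
    add_zero] at h₁

/-- Left multiplication by `(1 + a + ⋯ + a^q) - (1 + a + ⋯ + a^(q-1)) b` is surjective on the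
elements whose product with `1 + a + ⋯ + a^(N-1)` is invariant. -/
theorem exists_swan_mul_eq (h : IsDihedralTriple N a c b) [IsAddTorsionFree A] {q j t : ℕ}
    (hj : (2 * q + 1) * j = N * t + 1) {z : A}
    (hz : b * ((∑ i ∈ Finset.range N, a ^ i) * z) = (∑ i ∈ Finset.range N, a ^ i) * z) :
    ∃ y, ((∑ i ∈ Finset.range (q + 1), a ^ i) - (∑ i ∈ Finset.range q, a ^ i) * b) * y = z ∧
      (∑ i ∈ Finset.range N, a ^ i) * y = (∑ i ∈ Finset.range N, a ^ i) * z := by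
  have ha := mul_geom_sum_of_pow_eq_one a h.pow_eq_one
  have hba : (1 - b * a) * ((∑ i ∈ Finset.range N, a ^ i) * z) = 0 := by
    rw [sub_mul, one_mul, mul_assoc b, ← mul_assoc a, ha, hz, sub_self]
  have key : ∃ y, ((∑ i ∈ Finset.range (q + 1), a ^ i) - (∑ i ∈ Finset.range q, a ^ i) * b) * y
      = z := by
    -- The first term is the cofactor of v times an inverse modulo Σ, and v sends it to z + t Σ z.
    -- The second removes the error: Σ z is fixed by a and b, so v acts on it as (q + 1) - q = 1.
    refine ⟨((∑ i ∈ Finset.range (q + 1), a ^ i) + (∑ i ∈ Finset.range q, a ^ i) * b * a ^ q) *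
      ((∑ i ∈ Finset.range j, (a ^ (2 * q + 1)) ^ i) * z) -
      t * ((∑ i ∈ Finset.range N, a ^ i) * z), ?_⟩
    have hs : ((∑ i ∈ Finset.range (q + 1), a ^ i) - (∑ i ∈ Finset.range q, a ^ i) * b) *
        ((∑ i ∈ Finset.range N, a ^ i) * z) = (∑ i ∈ Finset.range N, a ^ i) * z := by
      have ha' : a * ((∑ i ∈ Finset.range N, a ^ i) * z) = (∑ i ∈ Finset.range N, a ^ i) * z := by
        rw [← mul_assoc, ha]
      rw [sub_mul, mul_assoc, hz, geom_sum_mul_of_mul_eq a _ ha', geom_sum_mul_of_mul_eq a _ ha']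
      push_cast
      noncomm_ring
    rw [mul_sub, ← mul_assoc, h.swan_mul_right, ← mul_assoc, geom_sum_mul_geom_sum_pow, hj,
      geom_sum_of_pow_eq_one a h.pow_eq_one, ← mul_assoc _ (t : A), ← Nat.cast_comm, mul_assoc, hs,
      add_mul, one_mul, mul_assoc, add_sub_cancel_right]
  obtain ⟨y, hy⟩ := key
  refine ⟨y, hy, ?_⟩
  have h₁ := congrArg (fun y => (∑ i ∈ Finset.range N, a ^ i) * y) hy
  simp only [← mul_assoc _ _ y, h.geom_sum_mul_swan] at h₁
  rw [mul_assoc, add_mul, one_mul, mul_assoc] at h₁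
  -- 1 - b a kills Σ z = (1 + q (1 - b a)) Σ y and satisfies (1 - b a)² = 2 (1 - b a).
  -- Torsion-freeness then gives (1 - b a) Σ y = 0.
  have h₂ : (2 * q + 1) • ((1 - b * a) * ((∑ i ∈ Finset.range N, a ^ i) * y)) = 0 := by
    have h₃ : (1 - b * a) * (1 - b * a) = 2 * (1 - b * a) := by
      rw [sub_mul 1, mul_sub (b * a), h.reflection_mul_sq]
      noncomm_ring
    rw [← h₁] at hba
    generalize (∑ i ∈ Finset.range N, a ^ i) * y = s at hba ⊢
    rw [mul_add, ← mul_assoc _ (q : A), ← Nat.cast_comm, mul_assoc (q : A),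
      ← mul_assoc (1 - b * a) (1 - b * a) s, h₃] at hba
    rw [← hba, nsmul_eq_mul]
    push_cast
    noncomm_ring
  rw [← h₁, (smul_eq_zero_iff_right (by omega)).1 h₂, mul_zero, add_zero]

end IsDihedralTriple

end DihedralRelations

/-! ### Invariants and augmentation ideal of the dihedral group ring -/

section DihedralGroupRing

open DihedralGroup

variable {N : ℕ}

theorem isDihedralTriple_of :
    IsDihedralTriple N (MonoidAlgebra.of ℤ (DihedralGroup N) (r 1))
      (MonoidAlgebra.of ℤ (DihedralGroup N) (r (-1)))
      (MonoidAlgebra.of ℤ (DihedralGroup N) (sr 0)) where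
  mul_inv := by rw [← map_mul]; simp [MonoidAlgebra.one_def]
  inv_mul := by rw [← map_mul]; simp [MonoidAlgebra.one_def]
  sq := by rw [← map_mul]; simp [MonoidAlgebra.one_def]
  conj := by rw [← map_mul, ← map_mul]; simp
  pow_eq_one := by rw [← map_pow]; simp [MonoidAlgebra.one_def]

/-- The augmentation `ℤ[G] → ℤ`. -/
def augmentation (G : Type) [Group G] : MonoidAlgebra ℤ G →+* ℤ :=
  (MonoidAlgebra.lift ℤ ℤ G 1).toRingHom

@[simp] theorem augmentation_of {G : Type} [Group G] (g : G) :
    augmentation G (MonoidAlgebra.of ℤ G g) = 1 := by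
  simp [augmentation]

theorem coeff_of_mul {G : Type} [Group G] (g h : G) (x : MonoidAlgebra ℤ G) :
    (MonoidAlgebra.of ℤ G g * x).coeff h = x.coeff (g⁻¹ * h) := by
  rw [MonoidAlgebra.of_apply, MonoidAlgebra.coeff_single_mul_apply, one_mul]

/-- An element invariant under a reflection is divisible by `1 + t`. -/
theorem exists_one_add_reflection_mul (i : ZMod N) (z : MonoidAlgebra ℤ (DihedralGroup N))
    (hz : MonoidAlgebra.of ℤ (DihedralGroup N) (sr i) * z = z) :
    ∃ y, z = (1 + MonoidAlgebra.of ℤ (DihedralGroup N) (sr i)) * y := by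
  classical
  -- Left multiplication by a reflection exchanges rotations and reflections, so the rotation half
  -- of z determines the rest.
  refine ⟨.ofCoeff (z.coeff.filter fun g => ∃ j, g = r j), ?_⟩
  ext g
  rw [add_mul, one_mul, MonoidAlgebra.coeff_add, Finsupp.add_apply, coeff_of_mul]
  cases g with
  | r j => simp
  | sr j =>
    conv_lhs => rw [← hz, coeff_of_mul]
    simp

theorem sum_range_of_r_pow [NeZero N] :
    ∑ k ∈ Finset.range N, MonoidAlgebra.of ℤ (DihedralGroup N) (r 1) ^ k =
      ∑ i : ZMod N, MonoidAlgebra.of ℤ (DihedralGroup N) (r i) := by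
  refine Finset.sum_bij' (fun k _ => (k : ZMod N)) (fun i _ => i.val) (fun _ _ => Finset.mem_univ _)
    (fun i _ => Finset.mem_range.2 i.val_lt)
    (fun k hk => ZMod.val_cast_of_lt (Finset.mem_range.1 hk)) (fun i _ => ZMod.natCast_zmod_val i)
    (fun k _ => by rw [← map_pow, r_one_pow])

/-- An element invariant under rotations is a multiple of the sum of the rotations. -/
theorem exists_geom_sum_mul [NeZero N] (z : MonoidAlgebra ℤ (DihedralGroup N))
    (hz : MonoidAlgebra.of ℤ (DihedralGroup N) (r 1) * z = z) :
    ∃ α β : ℤ, z = (∑ k ∈ Finset.range N, MonoidAlgebra.of ℤ (DihedralGroup N) (r 1) ^ k) *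
      (α • 1 + β • MonoidAlgebra.of ℤ (DihedralGroup N) (sr 0)) := by
  have hz' : ∀ i : ZMod N, MonoidAlgebra.of ℤ (DihedralGroup N) (r i) * z = z := fun i => by
    rw [← ZMod.natCast_zmod_val i, ← r_one_pow, map_pow]
    generalize i.val = k
    induction k with
    | zero => simp
    | succ k ih => rw [pow_succ, mul_assoc, hz, ih]
  refine ⟨z.coeff (r 0), z.coeff (sr 0), ?_⟩
  classical
  ext g
  simp only [sum_range_of_r_pow, Finset.sum_mul, MonoidAlgebra.coeff_sum, Finsupp.finsetSum_apply,
    coeff_of_mul]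
  cases g with
  | r j =>
    conv_lhs => rw [← hz' j, coeff_of_mul]
    simp [MonoidAlgebra.one_def, one_def, MonoidAlgebra.of_apply, Finsupp.single_apply,
      eq_comm (a := (0 : ZMod N)), neg_add_eq_zero, -r_zero]
  | sr j =>
    conv_lhs => rw [← hz' (-j), coeff_of_mul]
    simp [MonoidAlgebra.one_def, one_def, MonoidAlgebra.of_apply, Finsupp.single_apply,
      eq_comm (a := (0 : ZMod N)), add_eq_zero_iff_eq_neg', -r_zero]

theorem exists_augmentation_sub [NeZero N] (z : MonoidAlgebra ℤ (DihedralGroup N)) :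
    ∃ u v, z - augmentation _ z • 1 = (MonoidAlgebra.of ℤ (DihedralGroup N) (r 1) - 1) * u +
      (MonoidAlgebra.of ℤ (DihedralGroup N) (sr 0) - 1) * v := by
  have hr : ∀ i : ZMod N, ∃ u, MonoidAlgebra.of ℤ (DihedralGroup N) (r i) - 1 =
      (MonoidAlgebra.of ℤ (DihedralGroup N) (r 1) - 1) * u := fun i => by
    rw [← ZMod.natCast_zmod_val i, ← r_one_pow, map_pow]
    exact ⟨_, (mul_geom_sum _ _).symm⟩
  induction z using MonoidAlgebra.induction_on with
  | of g =>
    rw [augmentation_of, one_smul]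
    cases g with
    | r i =>
      obtain ⟨u, hu⟩ := hr i
      exact ⟨u, 0, by rw [hu, mul_zero, add_zero]⟩
    | sr i =>
      obtain ⟨u, hu⟩ := hr i
      -- b a^i - 1 = (a^i - 1) + (b - 1) a^i.
      refine ⟨u, MonoidAlgebra.of ℤ (DihedralGroup N) (r i), ?_⟩
      rw [← hu, sub_mul, ← map_mul, sr_mul_r, zero_add, one_mul]
      abel
  | add x y hx hy =>
    obtain ⟨u, v, h⟩ := hx
    obtain ⟨u', v', h'⟩ := hy
    refine ⟨u + u', v + v', ?_⟩
    rw [map_add, add_smul, add_sub_add_comm, h, h', mul_add, mul_add]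
    abel
  | smul k x hx =>
    obtain ⟨u, v, h⟩ := hx
    refine ⟨k • u, k • v, ?_⟩
    rw [map_zsmul, smul_assoc, ← smul_sub, h, smul_add, mul_smul_comm, mul_smul_comm]

end DihedralGroupRing

/-! ### The Cayley complex and its self maps -/

section DihedralComplex

open DihedralGroup

/-- The group ring is free of rank one as a right module over itself. -/
def groupRingUnop (G : Type) [Group G] :
    GroupRingOp G ≃ₗ[GroupRingOp G] MonoidAlgebra ℤ G :=
  { MulOpposite.opAddEquiv.symm with map_smul' := fun _ _ => rfl }

instance groupRing_free (G : Type) [Group G] :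
    Module.Free (GroupRingOp G) (MonoidAlgebra ℤ G) :=
  Module.Free.of_equiv (groupRingUnop G)

instance groupRing_finite (G : Type) [Group G] :
    Module.Finite (GroupRingOp G) (MonoidAlgebra ℤ G) :=
  Module.Finite.equiv (groupRingUnop G)

variable (n : ℕ)

theorem cayleyBoundaryTwo_mulVec (z : Fin 3 → MonoidAlgebra ℤ (DihedralGroup (2 * n))) :
    Matrix.mulVec (cayleyBoundaryTwo (dihedralGen n) (dihedralRel n)) z =
      ![(∑ i ∈ Finset.range (2 * n), MonoidAlgebra.of ℤ (DihedralGroup (2 * n)) (r 1) ^ i) * z 0 +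
          (1 + MonoidAlgebra.of ℤ (DihedralGroup (2 * n)) (sr 0) *
            MonoidAlgebra.of ℤ (DihedralGroup (2 * n)) (r 1)) * z 2,
        (1 + MonoidAlgebra.of ℤ (DihedralGroup (2 * n)) (sr 0)) * z 1 +
          (MonoidAlgebra.of ℤ (DihedralGroup (2 * n)) (r 1) - 1) * z 2] := by
  rw [cayleyBoundaryTwo_dihedral n _ _ rfl rfl]
  ext i : 1
  fin_cases i <;> simp [Matrix.mulVec, dotProduct, Fin.sum_univ_three]

theorem exists_cayleyBoundaryTwo_eq [NeZero n]
    (x y : MonoidAlgebra ℤ (DihedralGroup (2 * n)))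
    (hxy : (MonoidAlgebra.of ℤ (DihedralGroup (2 * n)) (r 1) - 1) * x +
      (MonoidAlgebra.of ℤ (DihedralGroup (2 * n)) (sr 0) - 1) * y = 0) :
    ∃ z, Matrix.mulVec (cayleyBoundaryTwo (dihedralGen n) (dihedralRel n)) z = ![x, y] := by
  have h := isDihedralTriple_of (N := 2 * n)
  have hba : MonoidAlgebra.of ℤ (DihedralGroup (2 * n)) (sr 0) *
      MonoidAlgebra.of ℤ (DihedralGroup (2 * n)) (r 1) =
      MonoidAlgebra.of ℤ (DihedralGroup (2 * n)) (sr 1) := by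
    rw [← map_mul]; simp
  have haug : augmentation _ (MonoidAlgebra.of ℤ (DihedralGroup (2 * n)) (r 1)) = 1 :=
    augmentation_of _
  have haug' : augmentation _ (MonoidAlgebra.of ℤ (DihedralGroup (2 * n)) (sr 0)) = 1 :=
    augmentation_of _
  have hinv := exists_geom_sum_mul (N := 2 * n)
  have hrefl := exists_one_add_reflection_mul (N := 2 * n)
  have hrefl₁ := hrefl 1
  rw [← hba] at hrefl₁
  simp only [cayleyBoundaryTwo_mulVec]
  have hrefl₀ := hrefl 0
  clear hrefl hba
  generalize MonoidAlgebra.of ℤ (DihedralGroup (2 * n)) (r 1) = a at *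
  generalize MonoidAlgebra.of ℤ (DihedralGroup (2 * n)) (sr 0) = b at *
  -- Multiplying the cycle condition by 1 + b eliminates y and turns (1 + b)(a - 1) into (a - 1)(1 -
  -- b a).
  have hx : a * ((1 - b * a) * x) = (1 - b * a) * x := by
    have := congrArg (fun t => (1 + b) * t) hxy
    simp only [mul_add, mul_zero] at this
    rw [← mul_assoc, ← mul_assoc, h.one_add_mul_sub_one, h.one_add_mul_sub_one_self, zero_mul,
      add_zero, mul_assoc, sub_mul, one_mul, sub_eq_zero] at this
    exact this
  obtain ⟨α, β, hαβ⟩ := hinv _ hx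
  -- 1 + b a annihilates the left side of `hαβ`, while the right side acquires augmentation 4n (α +
  -- β).
  have hsum : β = -α := by
    have := congrArg (fun t => augmentation _ ((1 + b * a) * t)) hαβ
    simp only [← mul_assoc, h.one_add_mul_one_sub, zero_mul, map_zero, map_mul, map_add, map_one,
      map_sum, map_pow, haug, haug', map_zsmul] at this
    have hn : n ≠ 0 := NeZero.ne n
    simp [hn] at this
    omega
  subst hsum
  -- Now (1 - b a) x = α Σ (1 - b) = (1 - b a) α Σ, so the difference x - α Σ is fixed by the
  -- reflection b a.
  obtain ⟨y₃, hy₃⟩ := hrefl₁ (x - α • ∑ i ∈ Finset.range (2 * n), a ^ i) (by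
    rw [eq_comm, ← sub_eq_zero]
    have : (1 - b * a) * (x - α • ∑ i ∈ Finset.range (2 * n), a ^ i) = 0 := by
      rw [mul_sub, hαβ, mul_smul_comm, sub_mul 1, mul_assoc,
        mul_geom_sum_of_pow_eq_one a h.pow_eq_one, h.reflection_mul_geom_sum]
      simp only [mul_add, mul_smul_comm, mul_one, one_mul, neg_smul, mul_neg, smul_sub]
      abel
    rwa [sub_mul, one_mul] at this)
  have hx' : x = (∑ i ∈ Finset.range (2 * n), a ^ i) * (α • 1) + (1 + b * a) * y₃ := by
    rw [← hy₃, mul_smul_comm, mul_one]; abel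
  obtain ⟨y₂, hy₂⟩ := hrefl₀ (y - (a - 1) * y₃) (by
    rw [eq_comm, ← sub_eq_zero]
    have h₁ : (a - 1) * x = (a - 1) * (1 + b * a) * y₃ := by
      rw [hx', mul_add, ← mul_assoc, sub_mul a 1 (Finset.sum _ _),
        mul_geom_sum_of_pow_eq_one a h.pow_eq_one, one_mul, sub_self, zero_mul, zero_add, mul_assoc]
    have h₂ := congrArg (· * y₃) h.sub_one_mul_one_add
    simp only [add_mul _ _ y₃, zero_mul, ← h₁] at h₂
    have : (b - 1) * (y - (a - 1) * y₃) = 0 := by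
      rw [mul_sub, ← mul_assoc, sub_eq_zero]
      exact add_left_cancel (hxy.trans h₂.symm)
    rw [sub_mul, one_mul] at this
    rw [← neg_sub, this, neg_zero])
  refine ⟨![α • 1, y₂, y₃], ?_⟩
  simp [← hy₂, hx']

/-- The augmented cellular chain complex of the Cayley complex, with a free module of rank `r`
added in degree two. -/
def dihedralComplex (r : ℕ) [NeZero n] : AugmentedTwoComplex (DihedralGroup (2 * n))
    ((Fin 3 → MonoidAlgebra ℤ (DihedralGroup (2 * n))) ×
      (Fin r → MonoidAlgebra ℤ (DihedralGroup (2 * n))))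
    (Fin 2 → MonoidAlgebra ℤ (DihedralGroup (2 * n)))
    (MonoidAlgebra ℤ (DihedralGroup (2 * n))) where
  d₂ := (Matrix.mulVecBilin (MonoidAlgebra ℤ (DihedralGroup (2 * n)))
    (GroupRingOp (DihedralGroup (2 * n))) (cayleyBoundaryTwo (dihedralGen n) (dihedralRel n))) ∘ₗ
      LinearMap.fst _ _ _
  d₁ := LinearMap.mulLeft (GroupRingOp (DihedralGroup (2 * n)))
      (MonoidAlgebra.of ℤ (DihedralGroup (2 * n)) (DihedralGroup.r 1) - 1) ∘ₗ LinearMap.proj 0 +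
    LinearMap.mulLeft (GroupRingOp (DihedralGroup (2 * n)))
      (MonoidAlgebra.of ℤ (DihedralGroup (2 * n)) (DihedralGroup.sr 0) - 1) ∘ₗ LinearMap.proj 1
  aug := (augmentation _).toAddMonoidHom
  exact w := by
    constructor
    · intro hw
      obtain ⟨z, hz⟩ := exists_cayleyBoundaryTwo_eq n (w 0) (w 1) hw
      refine ⟨(z, 0), hz.trans ?_⟩
      ext i : 1
      fin_cases i <;> rfl
    · rintro ⟨z, rfl⟩
      have h := isDihedralTriple_of (N := 2 * n)
      simp only [LinearMap.comp_apply, LinearMap.fst_apply, Matrix.mulVecBilin_apply,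
        cayleyBoundaryTwo_mulVec, LinearMap.add_apply, LinearMap.proj_apply,
        LinearMap.mulLeft_apply, Matrix.cons_val_zero, Matrix.cons_val_one]
      rw [mul_add, mul_add, ← mul_assoc, ← mul_assoc, ← mul_assoc, ← mul_assoc,
        h.sub_one_mul_one_add_self, sub_mul _ 1 (Finset.sum _ _),
        mul_geom_sum_of_pow_eq_one _ h.pow_eq_one, one_mul, sub_self, zero_mul, zero_mul, zero_add,
        zero_add, ← add_mul, h.sub_one_mul_one_add, zero_mul]
  exact_aug x := by
    constructor
    · intro hx
      obtain ⟨u, v, h⟩ := exists_augmentation_sub (N := 2 * n) x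
      have hx' : augmentation _ x = 0 := hx
      rw [hx', zero_smul, sub_zero] at h
      exact ⟨![u, v], h.symm⟩
    · rintro ⟨w, rfl⟩
      simp [- MonoidAlgebra.of_apply]
  surjective k := ⟨k • 1, by simp⟩
  aug_rightTranslate g x := by
    simp [rightTranslate_apply, - MonoidAlgebra.of_apply]

/-- The self map of `dihedralComplex n r` of degree `2q + 1` which is bijective on the second
homotopy module if `2q + 1` is prime to `2n`. -/
def dihedralSelfMap (r q : ℕ) [NeZero n] :
    (dihedralComplex n r).Hom (dihedralComplex n r) where
  f₂ := LinearMap.prodMap (LinearMap.pi ![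
      LinearMap.mulLeft _ ((∑ i ∈ Finset.range (q + 1),
          MonoidAlgebra.of ℤ (DihedralGroup (2 * n)) (DihedralGroup.r 1) ^ i) -
        (∑ i ∈ Finset.range q,
          MonoidAlgebra.of ℤ (DihedralGroup (2 * n)) (DihedralGroup.r 1) ^ i) *
          MonoidAlgebra.of ℤ (DihedralGroup (2 * n)) (DihedralGroup.sr 0)) ∘ₗ LinearMap.proj 0,
      LinearMap.proj 1, LinearMap.proj 2]) LinearMap.id
  f₁ := LinearMap.pi ![
      LinearMap.mulLeft _ (1 + (q : MonoidAlgebra ℤ (DihedralGroup (2 * n))) *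
        (1 - MonoidAlgebra.of ℤ (DihedralGroup (2 * n)) (DihedralGroup.sr 0) *
          MonoidAlgebra.of ℤ (DihedralGroup (2 * n)) (DihedralGroup.r 1))) ∘ₗ LinearMap.proj 0,
      LinearMap.proj 1]
  -- This element has augmentation 2q + 1. The factor 1 + b kills b - 1 and passes a - 1 to become 1
  -- - b a, which explains `f₁`.
  f₀ := LinearMap.mulLeft _ (1 + (q : MonoidAlgebra ℤ (DihedralGroup (2 * n))) *
      (1 + MonoidAlgebra.of ℤ (DihedralGroup (2 * n)) (DihedralGroup.sr 0)))
  deg := 2 * q + 1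
  comm₂ z := by
    have h := isDihedralTriple_of (N := 2 * n)
    simp only [dihedralComplex, LinearMap.comp_apply, LinearMap.fst_apply,
      Matrix.mulVecBilin_apply, cayleyBoundaryTwo_mulVec]
    ext i : 1
    fin_cases i
    · simp only [LinearMap.prodMap_apply, LinearMap.pi_apply, Matrix.cons_val_zero,
        Matrix.cons_val_one, Matrix.cons_val, LinearMap.comp_apply, LinearMap.proj_apply,
        LinearMap.mulLeft_apply, Fin.zero_eta]
      rw [← mul_assoc, h.geom_sum_mul_swan, mul_add _ (_ * _) (_ * _), mul_assoc,
        ← mul_assoc _ (1 + _) (z.1 2), add_mul 1 _ (1 + _), mul_assoc _ _ (1 + _),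
        h.one_sub_mul_one_add, mul_zero, add_zero, one_mul]
    · rfl
  comm₁ w := by
    have h := isDihedralTriple_of (N := 2 * n)
    simp only [dihedralComplex, LinearMap.comp_apply, LinearMap.add_apply, LinearMap.proj_apply,
      LinearMap.mulLeft_apply, LinearMap.pi_apply, Matrix.cons_val_zero, Matrix.cons_val_one]
    rw [mul_add, ← mul_assoc, ← mul_assoc, ← mul_assoc, mul_add (_ - 1), add_mul 1 _ (_ - 1),
      add_mul 1 _ (_ - 1), mul_assoc _ (1 + _), mul_assoc _ (1 + _), h.one_add_mul_sub_one_self,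
      h.one_add_mul_sub_one, 
      ← mul_assoc _ (q : MonoidAlgebra ℤ (DihedralGroup (2 * n))) (1 - _), ← Nat.cast_comm]
    simp only [mul_assoc, mul_one, one_mul, mul_zero, add_zero]
  aug_f₀ x := by
    simp [dihedralComplex, - MonoidAlgebra.of_apply]
    left; ring

/-- On the kernel Σ z₀ = -(1 + b a) z₂. If z₂ = 0 then Σ z₀ = 0, where v is injective; in general Σ
z₀ is fixed by b, which suffices to divide z₀ by v without changing Σ z₀, so the preimage stays in
the kernel. -/
theorem dihedralSelfMap_bijective (r q : ℕ) [NeZero n] (hq : (2 * q + 1).Coprime (2 * n)) :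
    ∃ φ : LinearMap.ker (dihedralComplex n r).d₂ ≃ₗ[GroupRingOp (DihedralGroup (2 * n))]
      LinearMap.ker (dihedralComplex n r).d₂,
      ∀ x, (φ x : _ × _) = (dihedralSelfMap n r q).f₂ x := by
  have hb := isDihedralTriple_of (N := 2 * n)
  have hn : 1 < 2 * n := by have := NeZero.pos n; omega
  obtain ⟨j, -, hj⟩ := Nat.exists_mul_mod_eq_one_of_coprime hq hn
  have hjt : (2 * q + 1) * j = 2 * n * ((2 * q + 1) * j / (2 * n)) + 1 := by
    conv_lhs => rw [← Nat.div_add_mod ((2 * q + 1) * j) (2 * n), hj]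
  refine ⟨LinearEquiv.ofBijective ((dihedralSelfMap n r q).f₂.restrict
    fun _ hx => (dihedralSelfMap n r q).f₂_mem hx) ⟨?_, ?_⟩, fun x => rfl⟩
  · rw [← LinearMap.ker_eq_bot, LinearMap.ker_eq_bot']
    rintro ⟨⟨z, w⟩, hz⟩ h0
    have h₁ := congrArg (fun t => (Subtype.val t).1) h0
    have h₂ : w = 0 := congrArg (fun t => (Subtype.val t).2) h0
    have e₀ := congrFun h₁ 0
    have e₁ : z 1 = 0 := congrFun h₁ 1
    have e₂ : z 2 = 0 := congrFun h₁ 2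
    have hz₀ := congrFun hz 0
    rw [dihedralComplex, LinearMap.comp_apply, LinearMap.fst_apply, Matrix.mulVecBilin_apply,
      cayleyBoundaryTwo_mulVec] at hz₀
    simp only [Matrix.cons_val_zero, e₂, mul_zero, add_zero] at hz₀
    have e₀' := hb.eq_zero_of_swan_mul_eq_zero hjt hz₀ e₀
    have hz' : z = 0 := by
      ext i : 1
      fin_cases i
      exacts [e₀', e₁, e₂]
    exact Subtype.ext (Prod.ext hz' h₂)
  · rintro ⟨⟨z, w⟩, hz⟩
    have hz' : (dihedralComplex n r).d₂ (z, w) = 0 := hz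
    rw [dihedralComplex, LinearMap.comp_apply, LinearMap.fst_apply, Matrix.mulVecBilin_apply,
      cayleyBoundaryTwo_mulVec] at hz'
    have hz₀ := congrFun hz' 0
    have hz₁ := congrFun hz' 1
    simp only [Matrix.cons_val_zero, Matrix.cons_val_one, Pi.zero_apply] at hz₀ hz₁
    obtain ⟨y, hy, hy'⟩ := hb.exists_swan_mul_eq hjt (z := z 0) (by
      have h₁ := mul_geom_sum_of_pow_eq_one _ hb.pow_eq_one
      have h₂ := hb.reflection_mul_sq
      generalize MonoidAlgebra.of ℤ (DihedralGroup (2 * n)) (DihedralGroup.r 1) = a at *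
      generalize MonoidAlgebra.of ℤ (DihedralGroup (2 * n)) (DihedralGroup.sr 0) = b at *
      conv_lhs => rw [← h₁, mul_assoc, ← mul_assoc b]
      rw [eq_neg_of_add_eq_zero_left hz₀, mul_neg, ← mul_assoc, mul_add, h₂, mul_one, add_comm])
    refine ⟨⟨(![y, z 1, z 2], w), ?_⟩, Subtype.ext (Prod.ext ?_ rfl)⟩
    · rw [LinearMap.mem_ker, dihedralComplex, LinearMap.comp_apply, LinearMap.fst_apply,
        Matrix.mulVecBilin_apply, cayleyBoundaryTwo_mulVec]
      simp only [Matrix.cons_val_zero, Matrix.cons_val_one, Matrix.cons_val, hy', hz₀, hz₁]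
      simp
    · ext i : 1
      fin_cases i
      exacts [hy, rfl, rfl]

end DihedralComplex

/-! ### Passage between augmented complexes and chain complexes -/

namespace AugmentedTwoComplex

variable {G : Type} [Group G]

section OfChainComplex

variable {X Y : ChainComplex (ModuleCat.{u} (GroupRingOp G)) ℕ}

/-- The augmented complex underlying an algebraic 2-complex. -/
theorem exists_of_isAlgebraicTwoComplex (hX : IsAlgebraicTwoComplex X) :
    ∃ A : AugmentedTwoComplex G (X.X 2) (X.X 1) (X.X 0),
      A.d₂ = (X.d 2 1).hom ∧ A.d₁ = (X.d 1 0).hom := by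
  obtain ⟨e, he⟩ := hX.coker
  exact ⟨{
    d₂ := (X.d 2 1).hom
    d₁ := (X.d 1 0).hom
    aug := e.toAddMonoidHom.comp (LinearMap.range (X.d 1 0).hom).mkQ.toAddMonoidHom
    exact := hX.exact
    exact_aug := fun x => by simp [Submodule.Quotient.mk_eq_zero]
    surjective := e.surjective.comp (Submodule.mkQ_surjective _)
    aug_rightTranslate := fun g x => he g (Submodule.Quotient.mk x) }, rfl, rfl⟩

/-- The map of chain complexes given by a chain map of the underlying augmented complexes. -/
def chainMap (hX : ∀ i, 2 < i → Limits.IsZero (X.X i))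
    {A : AugmentedTwoComplex G (X.X 2) (X.X 1) (X.X 0)}
    {B : AugmentedTwoComplex G (Y.X 2) (Y.X 1) (Y.X 0)}
    (hA₂ : A.d₂ = (X.d 2 1).hom) (hA₁ : A.d₁ = (X.d 1 0).hom)
    (hB₂ : B.d₂ = (Y.d 2 1).hom) (hB₁ : B.d₁ = (Y.d 1 0).hom) (f : Hom A B) : X ⟶ Y where
  f i := match i with
    | 0 => ModuleCat.ofHom f.f₀
    | 1 => ModuleCat.ofHom f.f₁
    | 2 => ModuleCat.ofHom f.f₂
    | _ + 3 => 0
  comm' i j hij := by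
    obtain rfl : j + 1 = i := hij
    match j with
    | 0 =>
      ext x
      have := f.comm₁ x
      rw [hA₁, hB₁] at this
      exact this
    | 1 =>
      ext x
      have := f.comm₂ x
      rw [hA₂, hB₂] at this
      exact this
    | k + 2 => exact (hX (k + 3) (by omega)).eq_of_src _ _

/-- A chain map of degree one which is the identity on the second homotopy module is homotopic to
the identity. -/
theorem nonempty_homotopy_id [Fintype G] (hX : IsAlgebraicTwoComplex X)
    {A : AugmentedTwoComplex G (X.X 2) (X.X 1) (X.X 0)}
    (hA₂ : A.d₂ = (X.d 2 1).hom) (hA₁ : A.d₁ = (X.d 1 0).hom) (f : Hom A A)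
    (hf : ∀ x, A.d₂ x = 0 → f.f₂ x = x) (hdeg : f.deg = 1) (φ : X ⟶ X)
    (h₂ : φ.f 2 = ModuleCat.ofHom f.f₂) (h₁ : φ.f 1 = ModuleCat.ofHom f.f₁)
    (h₀ : φ.f 0 = ModuleCat.ofHom f.f₀) : Nonempty (Homotopy φ (𝟙 X)) := by
  have := hX.finite
  have := hX.free
  obtain ⟨s₁, s₀, e₂, e₁, e₀⟩ := f.exists_homotopy_id hf hdeg
  refine ⟨{
    hom := fun i j => match i, j with
      | 0, 1 => ModuleCat.ofHom s₀
      | 1, 2 => ModuleCat.ofHom s₁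
      | _, _ => 0
    zero := fun i j hij => ?_
    comm := fun i => ?_ }⟩
  · match i, j with
    | 0, 1 => exact absurd rfl hij
    | 1, 2 => exact absurd rfl hij
    | 0, 0 => rfl
    | 0, _ + 2 => rfl
    | 1, 0 => rfl
    | 1, 1 => rfl
    | 1, _ + 3 => rfl
    | _ + 2, _ => rfl
  · match i with
    | 0 =>
      rw [Homotopy.dNext_zero_chainComplex, Homotopy.prevD_chainComplex, h₀]
      ext x
      have := e₀ x
      rw [hA₁] at this
      simpa using this
    | 1 =>
      rw [Homotopy.dNext_succ_chainComplex, Homotopy.prevD_chainComplex, h₁]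
      ext x
      have := e₁ x
      rw [hA₁, hA₂] at this
      simpa using this
    | 2 =>
      rw [Homotopy.dNext_succ_chainComplex, Homotopy.prevD_chainComplex, h₂]
      ext x
      have := e₂ x
      rw [hA₂] at this
      simpa using this
    | k + 3 => exact (hX.isZero (k + 3) (by omega)).eq_of_src _ _

/-- A chain map of degree one which is bijective on the second homotopy module is a homotopy
equivalence. -/
theorem nonempty_homotopyEquiv [Fintype G] (hX : IsAlgebraicTwoComplex X)
    (hY : IsAlgebraicTwoComplex Y)
    {A : AugmentedTwoComplex G (X.X 2) (X.X 1) (X.X 0)}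
    {B : AugmentedTwoComplex G (Y.X 2) (Y.X 1) (Y.X 0)}
    (hA₂ : A.d₂ = (X.d 2 1).hom) (hA₁ : A.d₁ = (X.d 1 0).hom)
    (hB₂ : B.d₂ = (Y.d 2 1).hom) (hB₁ : B.d₁ = (Y.d 1 0).hom) (f : Hom A B) (hdeg : f.deg = 1)
    (θ : LinearMap.ker A.d₂ ≃ₗ[GroupRingOp G] LinearMap.ker B.d₂)
    (hθ : ∀ x : LinearMap.ker A.d₂, f.f₂ x = θ x) : Nonempty (HomotopyEquiv X Y) := by
  have := hX.finite
  have := hX.free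
  have := hY.finite
  have := hY.free
  obtain ⟨g, hg⟩ := exists_hom (X := B) (Y := A) (θ.symm : _ →ₗ[GroupRingOp G] _)
  have hgf : ∀ x, A.d₂ x = 0 → (g.comp f).f₂ x = x := fun x hx => by
    change g.f₂ (f.f₂ x) = x
    rw [hθ ⟨x, hx⟩, hg]
    simp
  obtain ⟨t, ht⟩ := (g.comp f).deg_modEq_one hgf
  have ht' : g.deg = 1 + Fintype.card G * t := by
    rw [← ht]
    change g.deg = g.deg * f.deg
    rw [hdeg, mul_one]
  -- The inverse on π₂ extends to a map whose degree is 1 only modulo |G|; the correction makes both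
  -- composites have degree exactly 1.
  obtain ⟨g', hg'₂, hg'⟩ := g.exists_deg_add (-t)
  have hdeg' : g'.deg = 1 := by rw [hg', ht']; ring
  obtain ⟨H⟩ := nonempty_homotopy_id hX hA₂ hA₁ (g'.comp f) (fun x hx => by
      change g'.f₂ (f.f₂ x) = x
      rw [hg'₂]
      exact hgf x hx) (by
      change g'.deg * f.deg = 1
      rw [hdeg, hdeg', one_mul])
    (chainMap hX.isZero hA₂ hA₁ hB₂ hB₁ f ≫ chainMap hY.isZero hB₂ hB₁ hA₂ hA₁ g') rfl rfl rfl
  obtain ⟨K⟩ := nonempty_homotopy_id hY hB₂ hB₁ (f.comp g') (fun x hx => by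
      change f.f₂ (g'.f₂ x) = x
      rw [hg'₂, hg ⟨x, hx⟩, hθ]
      simp) (by
      change f.deg * g'.deg = 1
      rw [hdeg, hdeg', one_mul])
    (chainMap hY.isZero hB₂ hB₁ hA₂ hA₁ g' ≫ chainMap hX.isZero hA₂ hA₁ hB₂ hB₁ f) rfl rfl rfl
  exact ⟨⟨_, _, H, K⟩⟩

end OfChainComplex

section ToChainComplex

theorem exists_quotient_addEquiv_int {M : Type*} [AddCommGroup M] [Module (GroupRingOp G) M]
    (p : M →+ ℤ) (hp : Function.Surjective p) (L : Submodule (GroupRingOp G) M)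
    (hL : ∀ x, p x = 0 ↔ x ∈ L) (hinv : ∀ (g : G) x, p (rightTranslate g x) = p x) :
    ∃ e : (M ⧸ L) ≃+ ℤ, ∀ (g : G) (x : M ⧸ L),
      e (MulOpposite.op (MonoidAlgebra.of ℤ G g) • x) = e x := by
  refine ⟨(QuotientAddGroup.quotientAddEquivOfEq (M := L.toAddSubgroup) (N := p.ker)
    (AddSubgroup.ext fun x => (hL x).symm)).trans
      (QuotientAddGroup.quotientKerEquivOfSurjective p hp), fun g x => ?_⟩
  induction x using Submodule.Quotient.induction_on with
  | H x => exact hinv g x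

variable {X₂ X₁ X₀ : Type} [AddCommGroup X₂] [Module (GroupRingOp G) X₂] [AddCommGroup X₁]
  [Module (GroupRingOp G) X₁] [AddCommGroup X₀] [Module (GroupRingOp G) X₀]

/-- The modules of the chain complex of an augmented complex. -/
def chainComplexX (G : Type) [Group G] (X₂ X₁ X₀ : Type) [AddCommGroup X₂]
    [Module (GroupRingOp G) X₂] [AddCommGroup X₁] [Module (GroupRingOp G) X₁] [AddCommGroup X₀]
    [Module (GroupRingOp G) X₀] : ℕ → ModuleCat.{u} (GroupRingOp G)
  | 0 => ModuleCat.of _ (ULift X₀)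
  | 1 => ModuleCat.of _ (ULift X₁)
  | 2 => ModuleCat.of _ (ULift X₂)
  | _ + 3 => ModuleCat.of _ PUnit

/-- The differentials of the chain complex of an augmented complex. -/
def chainComplexD (A : AugmentedTwoComplex G X₂ X₁ X₀) :
    ∀ i, chainComplexX.{u} G X₂ X₁ X₀ (i + 1) ⟶ chainComplexX.{u} G X₂ X₁ X₀ i
  | 0 => ModuleCat.ofHom
      (ULift.moduleEquiv.symm.toLinearMap ∘ₗ A.d₁ ∘ₗ ULift.moduleEquiv.toLinearMap)
  | 1 => ModuleCat.ofHom
      (ULift.moduleEquiv.symm.toLinearMap ∘ₗ A.d₂ ∘ₗ ULift.moduleEquiv.toLinearMap)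
  | _ + 2 => 0

/-- The chain complex of an augmented complex, in an arbitrary universe. -/
def chainComplex (A : AugmentedTwoComplex G X₂ X₁ X₀) :
    ChainComplex (ModuleCat.{u} (GroupRingOp G)) ℕ :=
  ChainComplex.of (chainComplexX.{u} G X₂ X₁ X₀) A.chainComplexD fun i => by
    match i with
    | 0 =>
      ext x
      exact congrArg ULift.up (A.d₁_d₂ _)
    | _ + 1 => exact Limits.zero_comp

theorem chainComplex_d₂ (A : AugmentedTwoComplex G X₂ X₁ X₀) :
    (A.chainComplex.d 2 1).hom =
      (ULift.moduleEquiv.symm.toLinearMap ∘ₗ A.d₂ ∘ₗ ULift.moduleEquiv.toLinearMap :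
        ULift.{u} X₂ →ₗ[GroupRingOp G] ULift.{u} X₁) :=
  congrArg ModuleCat.Hom.hom (ChainComplex.of_d (chainComplexX.{u} G X₂ X₁ X₀) _ 1)

theorem chainComplex_d₁ (A : AugmentedTwoComplex G X₂ X₁ X₀) :
    (A.chainComplex.d 1 0).hom =
      (ULift.moduleEquiv.symm.toLinearMap ∘ₗ A.d₁ ∘ₗ ULift.moduleEquiv.toLinearMap :
        ULift.{u} X₁ →ₗ[GroupRingOp G] ULift.{u} X₀) :=
  congrArg ModuleCat.Hom.hom (ChainComplex.of_d (chainComplexX.{u} G X₂ X₁ X₀) _ 0)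

theorem chainComplex_isAlgebraicTwoComplex (A : AugmentedTwoComplex G X₂ X₁ X₀)
    [Module.Free (GroupRingOp G) X₂] [Module.Free (GroupRingOp G) X₁]
    [Module.Free (GroupRingOp G) X₀] [Module.Finite (GroupRingOp G) X₂]
    [Module.Finite (GroupRingOp G) X₁] [Module.Finite (GroupRingOp G) X₀] :
    IsAlgebraicTwoComplex.{u} A.chainComplex where
  free i := match i with
    | 0 => Module.Free.of_equiv (ULift.moduleEquiv (R := GroupRingOp G) (M := X₀)).symm
    | 1 => Module.Free.of_equiv (ULift.moduleEquiv (R := GroupRingOp G) (M := X₁)).symm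
    | 2 => Module.Free.of_equiv (ULift.moduleEquiv (R := GroupRingOp G) (M := X₂)).symm
    | _ + 3 => inferInstanceAs (Module.Free (GroupRingOp G) PUnit.{u + 1})
  finite i := match i with
    | 0 => Module.Finite.equiv (ULift.moduleEquiv (R := GroupRingOp G) (M := X₀)).symm
    | 1 => Module.Finite.equiv (ULift.moduleEquiv (R := GroupRingOp G) (M := X₁)).symm
    | 2 => Module.Finite.equiv (ULift.moduleEquiv (R := GroupRingOp G) (M := X₂)).symm
    | _ + 3 => inferInstanceAs (Module.Finite (GroupRingOp G) PUnit.{u + 1})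
  isZero i hi := by
    obtain ⟨k, rfl⟩ := Nat.exists_eq_add_of_le' hi
    exact ModuleCat.isZero_of_subsingleton (ModuleCat.of (GroupRingOp G) PUnit.{u + 1})
  exact := by
    rw [chainComplex_d₂, chainComplex_d₁]
    rintro ⟨x⟩
    constructor
    · intro hx
      obtain ⟨y, hy⟩ := (A.exact x).1 (congrArg ULift.down hx)
      exact ⟨⟨y⟩, congrArg ULift.up hy⟩
    · rintro ⟨⟨y⟩, hy⟩
      exact congrArg ULift.up ((A.exact x).2 ⟨y, congrArg ULift.down hy⟩)
  coker := by
    rw [chainComplex_d₁]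
    let p : ULift.{u} X₀ →+ ℤ := A.aug.comp (ULift.moduleEquiv (R := GroupRingOp G)).toAddMonoidHom
    have hp : ∀ x, p x = 0 ↔ x ∈ LinearMap.range (ULift.moduleEquiv.symm.toLinearMap ∘ₗ A.d₁ ∘ₗ
        ULift.moduleEquiv.toLinearMap : ULift.{u} X₁ →ₗ[GroupRingOp G] ULift.{u} X₀) := by
      rintro ⟨x⟩
      constructor
      · intro hx
        obtain ⟨y, hy⟩ := (A.exact_aug x).1 hx
        exact ⟨⟨y⟩, congrArg ULift.up hy⟩
      · rintro ⟨⟨y⟩, hy⟩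
        exact (A.exact_aug x).2 ⟨y, congrArg ULift.down hy⟩
    exact exists_quotient_addEquiv_int p (A.surjective.comp ULift.moduleEquiv.surjective) _ hp
      fun g x => A.aug_rightTranslate g x.down

/-- The second homotopy module of the chain complex of an augmented complex. -/
def piTwoEquiv (A : AugmentedTwoComplex G X₂ X₁ X₀) :
    algebraicPiTwo.{u} A.chainComplex ≃ₗ[GroupRingOp G] LinearMap.ker A.d₂ :=
  (LinearEquiv.ofEq _ _ (congrArg LinearMap.ker A.chainComplex_d₂)).trans
    { toFun := fun x => ⟨x.1.down, congrArg ULift.down x.2⟩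
      invFun := fun x => ⟨⟨x.1⟩, congrArg ULift.up x.2⟩
      map_add' := fun _ _ => rfl
      map_smul' := fun _ _ => rfl
      left_inv := fun _ => rfl
      right_inv := fun _ => rfl }

end ToChainComplex

end AugmentedTwoComplex

/-- The second homotopy module of `dihedralComplex n r` is `J ⊕ ℤ[D₄ₙ]^r`. -/
def dihedralComplexPiTwo (n r : ℕ) [NeZero n] :
    LinearMap.ker (dihedralComplex n r).d₂ ≃ₗ[GroupRingOp (DihedralGroup (2 * n))]
      dihedralJStab n r where
  toFun x := (⟨x.1.1, x.2⟩, x.1.2)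
  invFun x := ⟨(x.1.1, x.2), x.1.2⟩
  map_add' _ _ := rfl
  map_smul' _ _ := rfl
  left_inv _ := rfl
  right_inv _ := rfl

end

/-! ### The main theorem -/

theorem theorem2p11 (m : ℕ) (hm : 2 ≤ m) (n : ℕ) (hn : 4 * n = 2 ^ m) (r : ℕ) :
    (∃ X : ChainComplex (ModuleCat.{u} (GroupRingOp (DihedralGroup (2 * n)))) ℕ,
      IsAlgebraicTwoComplex X ∧
        Nonempty (algebraicPiTwo X ≃ₗ[GroupRingOp (DihedralGroup (2 * n))]
          dihedralJStab n r)) ∧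
    ∀ X Y : ChainComplex (ModuleCat.{u} (GroupRingOp (DihedralGroup (2 * n)))) ℕ,
      IsAlgebraicTwoComplex X → IsAlgebraicTwoComplex Y →
      Nonempty (algebraicPiTwo X ≃ₗ[GroupRingOp (DihedralGroup (2 * n))] dihedralJStab n r) →
      Nonempty (algebraicPiTwo Y ≃ₗ[GroupRingOp (DihedralGroup (2 * n))] dihedralJStab n r) →
      Nonempty (HomotopyEquiv X Y) := by
  have : NeZero n := ⟨by rintro rfl; exact pow_ne_zero m two_ne_zero hn.symm⟩
  refine ⟨⟨(dihedralComplex n r).chainComplex,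
    AugmentedTwoComplex.chainComplex_isAlgebraicTwoComplex _,
    ⟨(AugmentedTwoComplex.piTwoEquiv _).trans (dihedralComplexPiTwo n r)⟩⟩, ?_⟩
  rintro X Y hX hY ⟨eX⟩ ⟨eY⟩
  have := hX.finite
  have := hX.free
  have := hY.finite
  have := hY.free
  obtain ⟨A, hA₂, hA₁⟩ := AugmentedTwoComplex.exists_of_isAlgebraicTwoComplex hX
  obtain ⟨B, hB₂, hB₁⟩ := AugmentedTwoComplex.exists_of_isAlgebraicTwoComplex hY
  let θA : LinearMap.ker A.d₂ ≃ₗ[GroupRingOp (DihedralGroup (2 * n))]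
      LinearMap.ker (dihedralComplex n r).d₂ :=
    ((LinearEquiv.ofEq _ _ (congrArg LinearMap.ker hA₂)).trans eX).trans
      (dihedralComplexPiTwo n r).symm
  let θB : LinearMap.ker B.d₂ ≃ₗ[GroupRingOp (DihedralGroup (2 * n))]
      LinearMap.ker (dihedralComplex n r).d₂ :=
    ((LinearEquiv.ofEq _ _ (congrArg LinearMap.ker hB₂)).trans eY).trans
      (dihedralComplexPiTwo n r).symm
  obtain ⟨α, hα⟩ := AugmentedTwoComplex.exists_hom (X := A) (Y := dihedralComplex n r)
    (θA : _ →ₗ[GroupRingOp (DihedralGroup (2 * n))] _)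
  obtain ⟨β, hβ⟩ := AugmentedTwoComplex.exists_hom (X := dihedralComplex n r) (Y := B)
    (θB.symm : _ →ₗ[GroupRingOp (DihedralGroup (2 * n))] _)
  -- `β ∘ α` is an isomorphism on π₂, but its degree is only a unit modulo 4n; a self map of the
  -- Cayley complex of degree congruent to `l` has to be inserted between the two.
  obtain ⟨l, t, hl⟩ := (β.comp α).exists_deg_inverse (θA.trans θB.symm) fun x => by
    change β.f₂ (α.f₂ x) = _
    rw [hα, hβ]
    rfl
  have hcard : (Fintype.card (DihedralGroup (2 * n)) : ℤ) = 4 * n := by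
    rw [DihedralGroup.card]; push_cast; ring
  rw [hcard] at hl
  -- `l` is odd because it is invertible modulo 4n; reducing `l / 2` modulo 2n gives a natural
  -- number `q`.
  obtain ⟨q, s, hq⟩ : ∃ (q : ℕ) (s : ℤ), (2 * q + 1 : ℤ) = l + 4 * n * s := by
    have hn₀ : (2 * n : ℤ) ≠ 0 := by have := NeZero.ne n; omega
    have hodd : l % 2 = 1 := by
      rcases Int.emod_two_eq_zero_or_one l with h | h
      · obtain ⟨l', rfl⟩ := Int.dvd_of_emod_eq_zero h
        exfalso
        rw [mul_assoc, mul_assoc 4] at hl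
        omega
      · exact h
    refine ⟨((l / 2) % (2 * n)).toNat, -(l / 2 / (2 * n)), ?_⟩
    rw [Int.toNat_of_nonneg (Int.emod_nonneg _ hn₀)]
    have h₁ := Int.emod_add_mul_ediv (l / 2) (2 * n)
    have h₂ := Int.emod_add_mul_ediv l 2
    linear_combination 2 * h₁ + h₂ - hodd
  have hq' : (2 * q + 1 : ℤ) * (β.comp α).deg = 1 + 4 * n * (t + s * (β.comp α).deg) := by
    rw [hq]; linear_combination hl
  have hcop : (2 * q + 1).Coprime (2 * n) := by
    rw [← Nat.isCoprime_iff_coprime]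
    refine ⟨(β.comp α).deg, -2 * (t + s * (β.comp α).deg), ?_⟩
    push_cast
    linear_combination hq'
  obtain ⟨φ, hφ⟩ := dihedralSelfMap_bijective n r q hcop
  -- The composite has degree 1 modulo 4n by `hq'`; the norm correction makes it 1 without touching
  -- degree two.
  obtain ⟨γ, hγ₂, hγ⟩ := (β.comp ((dihedralSelfMap n r q).comp α)).exists_deg_add
    (-(t + s * (β.comp α).deg))
  refine AugmentedTwoComplex.nonempty_homotopyEquiv hX hY hA₂ hA₁ hB₂ hB₁ γ ?_
    ((θA.trans φ).trans θB.symm) fun x => ?_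
  · have h₁ : (β.comp ((dihedralSelfMap n r q).comp α)).deg = β.deg * ((2 * q + 1) * α.deg) := rfl
    have h₂ : (β.comp α).deg = β.deg * α.deg := rfl
    rw [hγ, h₁, hcard]
    rw [h₂] at hq' ⊢
    linear_combination hq'
  · rw [hγ₂]
    change β.f₂ ((dihedralSelfMap n r q).f₂ (α.f₂ x)) = _
    rw [hα]
    change β.f₂ ((dihedralSelfMap n r q).f₂ (θA x)) = _
    rw [← hφ, hβ]
    rfl
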